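/- Let $0<r_e<r_a<r_s$, set $\bar\varphi=\arccos(r_e/r_a)+\arccos(r_e/r_s)$, assume $\bar\varphi\le\pi/2$, and let $|\overline{AC}|=\sqrt{r_s^2+r_a^2-2r_sr_a\cos\bar\varphi}$. Let $\lambda,\mu>0$. The orbits are given by a Poisson point process $\Xi$ on $[0,\pi)\times[0,\pi)$ with density $\lambda\sin(\phi)/(2\pi)$; a point $(\theta,\phi)$ of $\Xi$ stands for the circular orbit of radius $r_s$ about the origin with longitude $\theta$ and inclination $\phi$. Conditionally on $\Xi$, the satellites $\Psi$ form independent Poisson point processes on the orbits, with intensity $\mu/(2\pi r_s)$ per unit arc length. The typical gateway is at $U=(0,0,r_e)$, the typical aerial platform at $A=(0,0,r_a)$. Let $D$ be the distance from $A$ to the nearest satellite in the extended spherical cap $\{x:\|x\|=r_s,\ \|x-A\|\le|\overline{AC}|\}$ ($D=\infty$ if there is none). The fading variables $H_s,H_a$ of the two links have a common law with complementary distribution function $\bar F_H(x)=\mathbb P(H\ge x)$, and $H_s$ is independent of $\Psi$. Let $\alpha\ge 2$, let $p_s,p_a,g_s,g_a,g_g,N_o,B_s,B_a>0$, and put $\eta_s=p_sg_ag_s/(N_oB_s)$,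 $\eta_a=p_ag_ag_g/(N_oB_a)$. The SNR of the platform is $\mathrm{SNR}_A=\eta_sH_sD^{-\alpha}$ (equal to $0$ if $D=\infty$), and the SNR of the gateway is $\mathrm{SNR}_U=\eta_aH_a|\overline{AU}|^{-\alpha}$. With $\zeta(z)=\arccos\big((r_s^2+r_a^2-z^2)/(2r_sr_a)\big)$ let $$k(z,v)=\frac{\lambda\mu z\,\exp\Big(-\frac{\mu}{\pi}\arcsin\sqrt{1-\frac{\cos^2\zeta(z)}{\cos^2 v}}-\lambda\int_0^{\zeta(z)}\cos w\Big(1-e^{-\frac{\mu}{\pi}\arcsin\sqrt{1-\cos^2\zeta(z)/\cos^2w}}\Big)\,dw\Big)}{\pi r_sr_a\sqrt{1-\cos^2\zeta(z)/\cos^2v}} .$$ Then: 1. On $\{D<\infty\}$ the distance $D$ has density $f_D(z)=\int_0^{\zeta(z)}k(z,v)\,dv$ on $[r_s-r_a,|\overline{AC}|]$, that is, $\mathbb P(D<\infty,\ D\in B)=\int_{B\cap[r_s-r_a,|\overline{AC}|]}f_D(z)\,dz$ for every Borel set $B\subseteq\mathbb R$; the function $k$ is integrable on $\{(z,v):r_s-r_a<z<|\overline{AC}|,\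 0<v<\zeta(z)\}$. 2. For every $\tau>0$ the SNR coverage probability of the typical aerial platform is $$\mathbb P(\mathrm{SNR}_A\ge\tau)=\int_{r_s-r_a}^{|\overline{AC}|}\int_0^{\zeta(z)}\bar F_H\!\left(\frac{\tau z^\alpha}{\eta_s}\right)k(z,v)\,dv\,dz ,$$ the integrand being integrable on the domain of part 1. 3. For every $\tau>0$ the SNR coverage probability of the typical gateway is $\mathbb P(\mathrm{SNR}_U\ge\tau)=\bar F_H\big(\tau(r_a-r_e)^\alpha/\eta_a\big)$. 4. For Nakagami fading with parameters $m,\Omega>0$, i.e. the law with density $\frac{x^{m-1}e^{-x/(m/\Omega)}}{\Gamma(m)(m/\Omega)^m}$ on $x\ge0$, this is a probability law, and $\bar F_H(x)=1-\gamma(m,\Omega x/m)/\Gamma(m)$ for $x\ge0$, where $\gamma$ is the lower incomplete gamma function. -/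

import Mathlib

open MeasureTheory ProbabilityTheory Set
open scoped ENNReal NNReal

noncomputable section

namespace SatNet

/-! ### Point processes, as random counting measures -/

/-- A counting measure `∑ᵢ δ_{xᵢ}`, the index `i` running over a (finite or infinite) set of
natural numbers. -/
def IsCountingMeasure {X : Type*} [MeasurableSpace X] (m : Measure X) : Prop :=
  ∃ (s : Set ℕ) (x : s → X), m = Measure.sum fun i => Measure.dirac (x i)

/-- The set of points of a counting measure. -/
def points {X : Type*} [MeasurableSpace X] (m : Measure X) : Set X := {x | m {x} ≠ 0}

/-- `N` is a Poisson point process with intensity measure `Λ`: the numbers of points in disjoint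
sets are independent, and the number of points in `B` is Poisson with mean `Λ B`. -/
structure IsPoissonProcess {Ω X : Type*} [MeasurableSpace Ω] [MeasurableSpace X]
    (N : Ω → Measure X) (Λ : Measure X) (P : Measure Ω) : Prop where
  measurable : Measurable N
  counting : ∀ᵐ ω ∂P, IsCountingMeasure (N ω)
  law : ∀ B, MeasurableSet B → Λ B ≠ ∞ →
    HasLaw (fun ω => N ω B) ((poissonMeasure (Λ B).toNNReal).map (fun k : ℕ => (k : ℝ≥0∞))) P
  indep : ∀ (n : ℕ) (B : Fin n → Set X), (∀ i, MeasurableSet (B i)) →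
    Pairwise (Function.onFun Disjoint B) → iIndepFun (fun i ω => N ω (B i)) P

/-- `N` is a Cox point process: conditionally on the sigma-algebra `𝓖`, it is a Poisson point
process whose intensity measure is the (random) measure `Λ`. -/
structure IsCoxProcess {Ω X : Type*} (𝓖 : MeasurableSpace Ω) [MeasurableSpace Ω]
    [MeasurableSpace X] (N : Ω → Measure X) (Λ : Ω → Measure X) (P : Measure Ω) : Prop where
  measurable : Measurable N
  counting : ∀ᵐ ω ∂P, IsCountingMeasure (N ω)
  condLaw : ∀ (n : ℕ) (B : Fin n → Set X) (k : Fin n → ℕ), (∀ i, MeasurableSet (B i)) →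
    Pairwise (Function.onFun Disjoint B) → (∀ i, ∀ᵐ ω ∂P, Λ ω (B i) ≠ ∞) →
    P⟦{ω | ∀ i, N ω (B i) = k i} | 𝓖⟧ =ᵐ[P]
      fun ω => ∏ i, (poissonMeasure (Λ ω (B i)).toNNReal).real {k i}

/-! ### Orbits and satellites -/

/-- Euclidean space of dimension three. -/
abbrev E3 : Type := EuclideanSpace ℝ (Fin 3)

/-- The point with argument angle `w` on the circular orbit of radius `rs` with longitude `o.1` and
inclination `o.2`: the point `(rs cos w, rs sin w)` of the horizontal circle, tilted by `o.2` about
the `x`-axis and then rotated by `o.1` about the `z`-axis. -/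
def satPos (rs : ℝ) (o : ℝ × ℝ) (w : ℝ) : E3 :=
  !₂[rs * (Real.cos w * Real.cos o.1 - Real.sin w * Real.cos o.2 * Real.sin o.1),
     rs * (Real.cos w * Real.sin o.1 + Real.sin w * Real.cos o.2 * Real.cos o.1),
     rs * (Real.sin w * Real.sin o.2)]

/-- The density `lam * sin φ / (2π)` of the orbit process on `[0, π) × [0, π)`. -/
def orbitProcessIntensity (lam : ℝ) : Measure (ℝ × ℝ) :=
  (volume.restrict (Ico 0 Real.pi ×ˢ Ico 0 Real.pi)).withDensity
    fun o => ENNReal.ofReal (lam * Real.sin o.2 / (2 * Real.pi))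

/-- Arc length (`rs` times the angle) on the orbit `o`, as a measure on the space. -/
def arcLength (rs : ℝ) (o : ℝ × ℝ) : Measure E3 :=
  (ENNReal.ofReal rs • volume.restrict (Ico 0 (2 * Real.pi))).map (satPos rs o)

/-- The intensity measure of the satellites on the orbit `o`: `mu / (2π rs)` per unit length. -/
def satIntensity (rs mu : ℝ) (o : ℝ × ℝ) : Measure E3 :=
  ENNReal.ofReal (mu / (2 * Real.pi * rs)) • arcLength rs o

theorem measurable_satPos (rs : ℝ) : Measurable (Function.uncurry (satPos rs)) := by
  have h0 : Continuous fun q : (ℝ × ℝ) × ℝ =>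
      rs * (Real.cos q.2 * Real.cos q.1.1 - Real.sin q.2 * Real.cos q.1.2 * Real.sin q.1.1) := by
    fun_prop
  have h1 : Continuous fun q : (ℝ × ℝ) × ℝ =>
      rs * (Real.cos q.2 * Real.sin q.1.1 + Real.sin q.2 * Real.cos q.1.2 * Real.cos q.1.1) := by
    fun_prop
  have h2 : Continuous fun q : (ℝ × ℝ) × ℝ => rs * (Real.sin q.2 * Real.sin q.1.2) := by
    fun_prop
  have h3 : Continuous (Function.uncurry (satPos rs)) :=
    (PiLp.continuous_toLp 2 _).comp
      (h0.matrixVecCons (h1.matrixVecCons (h2.matrixVecCons continuous_const)))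
  exact h3.measurable

theorem measurable_satIntensity (rs mu : ℝ) : Measurable (satIntensity rs mu) := by
  refine Measure.measurable_of_measurable_coe _ fun B hB => ?_
  have h : ∀ o, satIntensity rs mu o B =
      ENNReal.ofReal (mu / (2 * Real.pi * rs)) *
        (ENNReal.ofReal rs • volume.restrict (Ico 0 (2 * Real.pi)))
          (Prod.mk o ⁻¹' (Function.uncurry (satPos rs) ⁻¹' B)) := by
    intro o
    have ho : Measurable (satPos rs o) := (measurable_satPos rs).of_uncurry_left
    unfold satIntensity arcLength
    rw [Measure.smul_apply, smul_eq_mul, Measure.map_apply ho hB, ← preimage_comp]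
    rfl
  simp_rw [h]
  exact (measurable_measure_prodMk_left (measurable_satPos rs hB)).const_mul _

/-- Given the orbits, the intensity measure of the satellites: the sum of `satIntensity` over all
points of the orbit configuration `m`. -/
def totalSatIntensity (rs mu : ℝ) (m : Measure (ℝ × ℝ)) : Measure E3 :=
  m.bind (satIntensity rs mu)

/-- `Ξ` is the Poisson orbit process and, conditionally on `Ξ`, the satellites `Ψ` form independent
Poisson point processes on the orbits. -/
structure IsSatelliteNetwork {Ω : Type*} [MeasurableSpace Ω] (rs lam mu : ℝ)
    (Ξ : Ω → Measure (ℝ × ℝ)) (Ψ : Ω → Measure E3) (P : Measure Ω) : Prop where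
  orbits : IsPoissonProcess Ξ (orbitProcessIntensity lam) P
  satellites : IsCoxProcess (MeasurableSpace.comap Ξ inferInstance) Ψ
    (fun ω => totalSatIntensity rs mu (Ξ ω)) P

/-! ### The typical gateway and the typical aerial platform -/

/-- The point at distance `r` from the centre of the Earth, above the North pole. -/
def northPoint (r : ℝ) : E3 := !₂[0, 0, r]

/-- The central angle of the part of the satellite sphere visible from the platform. -/
def capAngle (re ra rs : ℝ) : ℝ := Real.arccos (re / ra) + Real.arccos (re / rs)

/-- The distance from the platform to the rim of the visible part of the satellite sphere. -/
def rimDist (re ra rs : ℝ) : ℝ :=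
  Real.sqrt (rs ^ 2 + ra ^ 2 - 2 * rs * ra * Real.cos (capAngle re ra rs))

/-- The extended spherical cap: the part of the satellite sphere visible from the platform. -/
def extendedCap (re ra rs : ℝ) : Set E3 :=
  {x | ‖x‖ = rs ∧ dist x (northPoint ra) ≤ rimDist re ra rs}

/-- The distance from the platform to its nearest satellite in the extended spherical cap, for the
satellite configuration `m`. It is `∞` if there is none. -/
def servingDist (re ra rs : ℝ) (m : Measure E3) : ℝ≥0∞ :=
  Metric.infEDist (northPoint ra) (points m ∩ extendedCap re ra rs)

open Classical in
/-- The SNR of the typical aerial platform: `p g H D ^ (-α) / (N₀ B)`, where `D` is the distance to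
the serving satellite. It is zero if there is no serving satellite. -/
def snrPlatform (re ra rs alpha ps gs ga N0 Bs H : ℝ) (m : Measure E3) : ℝ :=
  if servingDist re ra rs m = ∞ then 0
  else ps * (gs * ga) * H * (servingDist re ra rs m).toReal ^ (-alpha) / (N0 * Bs)

/-- The SNR of the typical gateway, which is served by the platform above it. -/
def snrGateway (re ra alpha pa ga gg N0 Ba H : ℝ) : ℝ :=
  pa * (ga * gg) * H * dist (northPoint ra) (northPoint re) ^ (-alpha) / (N0 * Ba)

/-! ### Fading -/

/-- The complementary distribution function `x ↦ P(H ≥ x)` of a law on the real line. -/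
def ccdf (ν : Measure ℝ) (x : ℝ) : ℝ := ν.real (Ici x)

/-- The Nakagami fading law, of density
`x ^ (m - 1) * exp (-x / (m / W)) / (Γ(m) * (m / W) ^ m)` on `x ≥ 0`. -/
def nakagamiLaw (m W : ℝ) : Measure ℝ :=
  volume.withDensity fun x => ENNReal.ofReal
    (if 0 ≤ x then x ^ (m - 1) * Real.exp (-x / (m / W)) / (Real.Gamma m * (m / W) ^ m) else 0)

/-- The lower incomplete gamma function. -/
def lowerGamma (s x : ℝ) : ℝ := ∫ t in (0 : ℝ)..x, t ^ (s - 1) * Real.exp (-t)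

/-! ### The closed-form expression -/

/-- The critical angle `ζ(z)`. -/
def zeta (ra rs z : ℝ) : ℝ := Real.arccos ((rs ^ 2 + ra ^ 2 - z ^ 2) / (2 * rs * ra))

/-- `√(1 - cos² ζ(z) / cos² v)`. -/
def root (ra rs z v : ℝ) : ℝ :=
  Real.sqrt (1 - Real.cos (zeta ra rs z) ^ 2 / Real.cos v ^ 2)

/-- The integrand, without its fading factor. Its integral over `0 < v < ζ(z)` is the density at `z`
of the distance to the serving satellite. -/
def rangeKernel (lam mu ra rs z v : ℝ) : ℝ :=
  lam * mu * z *
    Real.exp (-(mu / Real.pi) * Real.arcsin (root ra rs z v)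
      - lam * ∫ w in (0 : ℝ)..zeta ra rs z,
          Real.cos w * (1 - Real.exp (-(mu / Real.pi) * Real.arcsin (root ra rs z w)))) /
    (Real.pi * rs * ra * root ra rs z v)

/-- The domain of integration `{(z, v) : rs - ra < z < |AC|, 0 < v < ζ(z)}`. -/
def integrationDomain (re ra rs : ℝ) : Set (ℝ × ℝ) :=
  {q | q.1 ∈ Ioo (rs - ra) (rimDist re ra rs) ∧ q.2 ∈ Ioo 0 (zeta ra rs q.1)}

end SatNet

end

/-! The law of the serving distance D comes from void probabilities. Given the orbits, a region B is
empty with probability exp of minus its total satellite intensity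
(`IsCoxProcess.measureReal_eq_zero`). Averaging over the orbits with the Laplace functional of a
Poisson process gives exp(-∫(1 - e^{-m(o,B)}) dΛ(o)), where Λ is the orbit intensity and m(o,B) the
satellite intensity of orbit o on B.

For the cap of points within distance z of the platform, an orbit of inclination φ meets B in an arc
of angle 2 arccos(c(z)/sin φ), where c = `cosAngle` = cos ζ. Folding φ about π/2 gives P(D < z) = 1
- exp(-λJ(z)) with J = `meanHits`, for z between rs - ra and the rim distance.

Differentiating J directly would meet a moving endpoint ζ(z) and an inverse-square-root singularity
there. Instead, for each fixed v the integrand of J is the integral over t of its own t-derivative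
`hitDensity` (`lintegral_hitDensity_left`), and Tonelli writes J as a double integral
(`ofReal_meanHits`). The chain rule for absolutely continuous functions then yields 1 - exp(-λJ(z))
as the integral of `servingKernel` (`lintegral_servingKernel`), which equals `rangeKernel` for v <
ζ(z) and vanishes for larger v up to π/2.

Two finite measures with the same mass on half-lines and the same total mass coincide, which gives
the law of D on {D < ∞} (`map_countingServingDist`). Platform coverage is the event that H exceeds a
threshold depending on D, so independence and Tonelli conclude. The gateway has a deterministic
distance, and Nakagami fading is a gamma law. -/

namespace SatNet

open Filter Topology

/-! ### Laplace functional of a Poisson process -/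

section Poisson

variable {Ω X : Type*} [MeasurableSpace Ω] [MeasurableSpace X] {N : Ω → Measure X}
  {Λ : Measure X} {P : Measure Ω}

theorem integral_exp_neg_mul_poissonMeasure (r : ℝ≥0) (c : ℝ) :
    ∫ n : ℕ, Real.exp (-(c * n)) ∂poissonMeasure r = Real.exp (-(r * (1 - Real.exp (-c)))) := by
  rw [integral_poissonMeasure]
  have h : ∀ n : ℕ, (Real.exp (-(r : ℝ)) * (r : ℝ) ^ n / (n.factorial : ℝ)) •
      Real.exp (-(c * n)) =
      Real.exp (-(r : ℝ)) * (((r : ℝ) * Real.exp (-c)) ^ n / (n.factorial : ℝ)) := by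
    intro n
    have : Real.exp (-(c * n)) = Real.exp (-c) ^ n := by
      rw [← Real.exp_nat_mul]; ring_nf
    rw [this, mul_pow, smul_eq_mul]; ring
  simp_rw [h]
  rw [tsum_mul_left]
  have := congrFun Real.exp_eq_exp_ℝ ((r : ℝ) * Real.exp (-c))
  rw [NormedSpace.exp_eq_tsum_div] at this
  beta_reduce at this
  rw [← this, ← Real.exp_add]
  ring_nf

namespace IsPoissonProcess

theorem ae_ne_top (hN : IsPoissonProcess N Λ P) {B : Set X} (hB : MeasurableSet B)
    (hΛ : Λ B ≠ ∞) : ∀ᵐ ω ∂P, N ω B ≠ ∞ := by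
  have hl := hN.law B hB hΛ
  have : ∀ᵐ x ∂(P.map fun ω => N ω B), x ≠ ∞ := by
    rw [hl.map_eq]
    rw [ae_map_iff (by fun_prop) (by measurability)]
    simp
  exact ae_of_ae_map hl.aemeasurable this

theorem integral_exp_neg_mul (hN : IsPoissonProcess N Λ P) {B : Set X} (hB : MeasurableSet B)
    (hΛ : Λ B ≠ ∞) (c : ℝ) :
    ∫ ω, Real.exp (-(c * (N ω B).toReal)) ∂P =
      Real.exp (-((Λ B).toReal * (1 - Real.exp (-c)))) := by
  have hl := hN.law B hB hΛ
  have hm : Measurable fun x : ℝ≥0∞ => Real.exp (-(c * x.toReal)) := by fun_prop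
  have h1 : ∫ ω, Real.exp (-(c * (N ω B).toReal)) ∂P =
      ∫ x, Real.exp (-(c * x.toReal)) ∂(P.map fun ω => N ω B) :=
    (integral_map hl.aemeasurable hm.aestronglyMeasurable).symm
  rw [h1, hl.map_eq, integral_map (by fun_prop) hm.aestronglyMeasurable]
  simp_rw [ENNReal.toReal_natCast]
  rw [integral_exp_neg_mul_poissonMeasure, ENNReal.coe_toNNReal_eq_toReal]

/-- The level sets of `s` are disjoint, so their counts are independent. The expectation factors
into Poisson Laplace transforms, whose exponents add up to the integral on the right. -/
theorem integral_exp_neg_lintegral_simpleFunc [IsProbabilityMeasure P]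
    (hN : IsPoissonProcess N Λ P) [IsFiniteMeasure Λ] (s : SimpleFunc X ℝ≥0∞)
    (hs : ∀ x, s x < ∞) :
    ∫ ω, Real.exp (-(∫⁻ x, s x ∂N ω).toReal) ∂P =
      Real.exp (-∫ x, (1 - Real.exp (-(s x).toReal)) ∂Λ) := by
  let e := s.range.equivFin.symm
  let B : Fin s.range.card → Set X := fun i => s ⁻¹' {(e i : ℝ≥0∞)}
  have hB : ∀ i, MeasurableSet (B i) := fun i => s.measurableSet_preimage _
  have hdisj : Pairwise (Function.onFun Disjoint B) := by
    intro i j hij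
    refine Disjoint.preimage _ ?_
    rw [disjoint_singleton]
    intro h
    exact hij (e.injective (Subtype.ext h))
  have hind := hN.indep _ B hB hdisj
  have htop : ∀ i, (e i : ℝ≥0∞) ≠ ∞ := by
    intro i
    obtain ⟨x, hx⟩ := SimpleFunc.mem_range.1 (e i).2
    rw [← hx]; exact (hs x).ne
  have hsum : ∀ ω, ∫⁻ x, s x ∂N ω = ∑ i, (e i : ℝ≥0∞) * N ω (B i) := by
    intro ω
    rw [SimpleFunc.lintegral_eq_lintegral, SimpleFunc.lintegral, ← Finset.sum_coe_sort]
    exact (Equiv.sum_comp e fun y : s.range => (y : ℝ≥0∞) * N ω (s ⁻¹' {(y : ℝ≥0∞)})).symm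
  have hfin : ∀ᵐ ω ∂P, ∀ i, N ω (B i) ≠ ∞ :=
    ae_all_iff.2 fun i => hN.ae_ne_top (hB i) (measure_ne_top _ _)
  have h1 : ∫ ω, Real.exp (-(∫⁻ x, s x ∂N ω).toReal) ∂P =
      ∫ ω, ∏ i, Real.exp (-((e i : ℝ≥0∞).toReal * (N ω (B i)).toReal)) ∂P := by
    refine integral_congr_ae ?_
    filter_upwards [hfin] with ω hω
    rw [hsum, ENNReal.toReal_sum fun i _ => ENNReal.mul_ne_top (htop i) (hω i),
      ← Finset.sum_neg_distrib, Real.exp_sum]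
    simp_rw [ENNReal.toReal_mul]
  have hmeas : ∀ i, Measurable fun ω => N ω (B i) := fun i =>
    (Measure.measurable_coe (hB i)).comp hN.measurable
  have h2 := hind.integral_fun_prod_comp (fun i => (hmeas i).aemeasurable)
    (f := fun i (y : ℝ≥0∞) => Real.exp (-((e i : ℝ≥0∞).toReal * y.toReal)))
    fun i => Measurable.aestronglyMeasurable (by fun_prop)
  rw [h1, h2]
  simp_rw [hN.integral_exp_neg_mul (hB _) (measure_ne_top Λ _)]
  rw [← Real.exp_sum, Finset.sum_neg_distrib]
  congr 2
  calc ∑ i, (Λ (B i)).toReal * (1 - Real.exp (-(e i : ℝ≥0∞).toReal))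
      = ∑ i, ∫ x, (B i).indicator (fun _ => 1 - Real.exp (-(e i : ℝ≥0∞).toReal)) x ∂Λ := by
        refine Finset.sum_congr rfl fun i _ => ?_
        rw [integral_indicator_const _ (hB i)]; rfl
    _ = ∫ x, ∑ i, (B i).indicator (fun _ => 1 - Real.exp (-(e i : ℝ≥0∞).toReal)) x ∂Λ :=
        (integral_finsetSum _ fun i _ => (integrable_const _).indicator (hB i)).symm
    _ = ∫ x, (1 - Real.exp (-(s x).toReal)) ∂Λ := by
        refine integral_congr_ae (ae_of_all _ fun x => ?_)
        -- Each x lies in exactly one level set, so a single indicator survives.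
        let i₀ := e.symm ⟨s x, s.mem_range_self x⟩
        have hi₀ : (e i₀ : ℝ≥0∞) = s x := by simp [i₀]
        beta_reduce
        rw [Finset.sum_eq_single i₀]
        · rw [indicator_of_mem, hi₀]
          exact hi₀.symm
        · intro j _ hj
          refine indicator_of_notMem (fun hx => hj ?_) _
          have : s x = (e j : ℝ≥0∞) := hx
          exact e.injective (Subtype.ext (this.symm.trans hi₀.symm))
        · simp

/-- The Laplace functional of a Poisson point process. -/
theorem integral_exp_neg_lintegral [IsProbabilityMeasure P]
    (hN : IsPoissonProcess N Λ P) [IsFiniteMeasure Λ] {f : X → ℝ≥0∞} (hf : Measurable f)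
    {C : ℝ≥0∞} (hC : C ≠ ∞) (hfC : ∀ x, f x ≤ C) :
    ∫ ω, Real.exp (-(∫⁻ x, f x ∂N ω).toReal) ∂P =
      Real.exp (-∫ x, (1 - Real.exp (-(f x).toReal)) ∂Λ) := by
  have hfin : ∀ᵐ ω ∂P, N ω univ ≠ ∞ := hN.ae_ne_top MeasurableSet.univ (measure_ne_top _ _)
  have hmeas : ∀ s : X → ℝ≥0∞, Measurable s →
      AEStronglyMeasurable (fun ω => Real.exp (-(∫⁻ x, s x ∂N ω).toReal)) P := fun s hs => by
    have : Measurable fun ω => ∫⁻ x, s x ∂N ω :=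
      (Measure.measurable_lintegral hs).comp hN.measurable
    exact Measurable.aestronglyMeasurable (by fun_prop)
  have hle1 : ∀ x : ℝ≥0∞, Real.exp (-x.toReal) ≤ 1 := fun x => by simp
  have hL : Tendsto (fun n => ∫ ω, Real.exp (-(∫⁻ x, SimpleFunc.eapprox f n x ∂N ω).toReal) ∂P)
      atTop (𝓝 (∫ ω, Real.exp (-(∫⁻ x, f x ∂N ω).toReal) ∂P)) := by
    refine tendsto_integral_of_dominated_convergence (fun _ => 1)
      (fun n => hmeas _ (SimpleFunc.measurable _)) (integrable_const _)
      (fun n => ae_of_all _ fun ω => ?_) ?_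
    · rw [Real.norm_of_nonneg (Real.exp_nonneg _)]; exact hle1 _
    · filter_upwards [hfin] with ω hω
      -- `toReal` is continuous only at finite values; the bound on `f` and the finite number of
      -- points keep the limit finite.
      have ht : ∫⁻ x, f x ∂N ω ≠ ∞ := by
        refine ne_top_of_le_ne_top (ENNReal.mul_ne_top hC hω) ?_
        rw [← lintegral_const]
        exact lintegral_mono hfC
      refine (Real.continuous_exp.tendsto _).comp (Tendsto.neg ?_)
      refine (ENNReal.tendsto_toReal ht).comp ?_
      exact lintegral_tendsto_of_tendsto_of_monotone
        (fun n => (SimpleFunc.measurable _).aemeasurable)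
        (ae_of_all _ fun x n m h => SimpleFunc.monotone_eapprox f h x)
        (ae_of_all _ fun x => SimpleFunc.tendsto_eapprox hf x)
  have hR : Tendsto
      (fun n => Real.exp (-∫ x, (1 - Real.exp (-(SimpleFunc.eapprox f n x).toReal)) ∂Λ))
      atTop (𝓝 (Real.exp (-∫ x, (1 - Real.exp (-(f x).toReal)) ∂Λ))) := by
    refine (Real.continuous_exp.tendsto _).comp (Tendsto.neg ?_)
    refine tendsto_integral_of_dominated_convergence (fun _ => 1)
      (fun n => ?_) (integrable_const _) (fun n => ae_of_all _ fun ω => ?_)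
      (ae_of_all _ fun x => ?_)
    · have := (SimpleFunc.eapprox f n).measurable
      exact Measurable.aestronglyMeasurable (by fun_prop)
    · rw [Real.norm_of_nonneg (sub_nonneg.2 (hle1 _))]
      linarith [Real.exp_pos (-(SimpleFunc.eapprox f n ω).toReal)]
    · refine tendsto_const_nhds.sub ((Real.continuous_exp.tendsto _).comp (Tendsto.neg ?_))
      exact (ENNReal.tendsto_toReal (ne_top_of_le_ne_top hC (hfC x))).comp
        (SimpleFunc.tendsto_eapprox hf x)
  refine tendsto_nhds_unique hL (hR.congr fun n => ?_)
  exact (hN.integral_exp_neg_lintegral_simpleFunc _ (SimpleFunc.eapprox_lt_top f n)).symm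

end IsPoissonProcess

end Poisson

/-! ### Void probabilities of the satellite process -/

/-- The void probabilities of a Cox process. -/
theorem IsCoxProcess.measureReal_eq_zero {Ω X : Type*} {𝓖 : MeasurableSpace Ω}
    [mΩ : MeasurableSpace Ω] [MeasurableSpace X] {N : Ω → Measure X} {P : Measure Ω}
    [IsProbabilityMeasure P] {Γ : Ω → Measure X} (h𝓖 : 𝓖 ≤ mΩ) (hN : IsCoxProcess 𝓖 N Γ P)
    {B : Set X} (hB : MeasurableSet B) (hΓ : ∀ᵐ ω ∂P, Γ ω B ≠ ∞) :
    P.real {ω | N ω B = 0} = ∫ ω, Real.exp (-(Γ ω B).toReal) ∂P := by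
  have h := hN.condLaw 1 (fun _ => B) (fun _ => 0) (fun _ => hB)
    (fun i j hij => absurd (Subsingleton.elim i j) hij) fun _ => hΓ
  have hset : {ω | ∀ i : Fin 1, N ω B = ((0 : ℕ) : ℝ≥0∞)} = {ω | N ω B = 0} := by
    ext; simp
  have hmeas : MeasurableSet {ω | N ω B = 0} :=
    (Measure.measurable_coe hB).comp hN.measurable (measurableSet_singleton 0)
  rw [hset] at h
  -- Integrating the conditional void probability, the Poisson mass at 0, recovers the unconditional
  -- one.
  have h2 := integral_condExp (μ := P) h𝓖 (f := {ω | N ω B = 0}.indicator fun _ => (1 : ℝ))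
  rw [integral_indicator_const _ hmeas, smul_eq_mul, mul_one] at h2
  rw [← h2, integral_congr_ae h]
  refine integral_congr_ae (ae_of_all _ fun ω => ?_)
  simp [poissonMeasure_real_singleton, ENNReal.coe_toNNReal_eq_toReal]

instance (lam : ℝ) : IsFiniteMeasure (orbitProcessIntensity lam) := by
  refine isFiniteMeasure_withDensity ?_
  have hfin : volume (Ico 0 Real.pi ×ˢ Ico 0 Real.pi) ≠ ∞ := by
    rw [Measure.volume_eq_prod, Measure.prod_prod]
    simp [ENNReal.mul_eq_top]
  refine ne_top_of_le_ne_top (ENNReal.mul_ne_top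
    (ENNReal.ofReal_ne_top (r := |lam| / (2 * Real.pi))) hfin) ?_
  rw [← setLIntegral_const]
  refine lintegral_mono fun o => ENNReal.ofReal_le_ofReal ?_
  refine div_le_div_of_nonneg_right ?_ (by positivity)
  calc lam * Real.sin o.2 ≤ |lam * Real.sin o.2| := le_abs_self _
    _ = |lam| * |Real.sin o.2| := abs_mul _ _
    _ ≤ |lam| * 1 := mul_le_mul_of_nonneg_left (Real.abs_sin_le_one _) (abs_nonneg _)
    _ = |lam| := mul_one _

theorem satIntensity_apply (rs mu : ℝ) (o : ℝ × ℝ) {B : Set E3} (hB : MeasurableSet B) :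
    satIntensity rs mu o B = ENNReal.ofReal (mu / (2 * Real.pi * rs)) *
      (ENNReal.ofReal rs * volume (satPos rs o ⁻¹' B ∩ Ico 0 (2 * Real.pi))) := by
  have ho : Measurable (satPos rs o) := (measurable_satPos rs).of_uncurry_left
  rw [satIntensity, arcLength, Measure.smul_apply, smul_eq_mul, Measure.map_apply ho hB,
    Measure.smul_apply, smul_eq_mul, Measure.restrict_apply (ho hB)]

/-- The bound does not depend on the orbit. It serves as the constant in the Laplace functional and
makes the total satellite intensity almost surely finite. -/
theorem satIntensity_le (rs mu : ℝ) (o : ℝ × ℝ) {B : Set E3} (hB : MeasurableSet B) :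
    satIntensity rs mu o B ≤ ENNReal.ofReal (mu / (2 * Real.pi * rs)) *
      (ENNReal.ofReal rs * ENNReal.ofReal (2 * Real.pi)) := by
  rw [satIntensity_apply rs mu o hB]
  gcongr
  refine (measure_mono inter_subset_right).trans ?_
  simp

/-- The probability that a region contains no satellite. -/
theorem IsSatelliteNetwork.measureReal_eq_zero {Ω : Type*} [MeasurableSpace Ω] {P : Measure Ω}
    [IsProbabilityMeasure P] {rs lam mu : ℝ} {Ξ : Ω → Measure (ℝ × ℝ)} {Ψ : Ω → Measure E3}
    (h : IsSatelliteNetwork rs lam mu Ξ Ψ P) {B : Set E3} (hB : MeasurableSet B) :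
    P.real {ω | Ψ ω B = 0} =
      Real.exp (-∫ o, (1 - Real.exp (-(satIntensity rs mu o B).toReal))
        ∂orbitProcessIntensity lam) := by
  have hf : Measurable fun o => satIntensity rs mu o B :=
    (Measure.measurable_coe hB).comp (measurable_satIntensity rs mu)
  have hT : ∀ ω, totalSatIntensity rs mu (Ξ ω) B = ∫⁻ o, satIntensity rs mu o B ∂Ξ ω := fun ω =>
    Measure.bind_apply hB (measurable_satIntensity rs mu).aemeasurable
  have hC : ENNReal.ofReal (mu / (2 * Real.pi * rs)) *
      (ENNReal.ofReal rs * ENNReal.ofReal (2 * Real.pi)) ≠ ∞ :=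
    ENNReal.mul_ne_top ENNReal.ofReal_ne_top
      (ENNReal.mul_ne_top ENNReal.ofReal_ne_top ENNReal.ofReal_ne_top)
  have hfC := fun o => satIntensity_le rs mu o hB
  rw [h.satellites.measureReal_eq_zero h.orbits.measurable.comap_le hB, ←
    h.orbits.integral_exp_neg_lintegral hf hC hfC]
  · simp_rw [hT]
  · filter_upwards [h.orbits.ae_ne_top MeasurableSet.univ (measure_ne_top _ _)] with ω hω
    rw [hT]
    refine ne_top_of_le_ne_top (ENNReal.mul_ne_top hC hω) ?_
    rw [← lintegral_const]
    exact lintegral_mono hfC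

/-! ### Orbits meeting a spherical cap -/

noncomputable section

/-- The cosine of the central angle between the north pole and the points of the sphere of radius
`rs` at distance `z` from the platform. -/
def cosAngle (ra rs z : ℝ) : ℝ := (rs ^ 2 + ra ^ 2 - z ^ 2) / (2 * rs * ra)

/-- Up to the factor `lam`, the mean number of orbits with a satellite at distance less than `z`
from the platform. -/
def meanHits (mu ra rs z : ℝ) : ℝ :=
  ∫ v in (0 : ℝ)..Real.pi / 2,
    Real.cos v * (1 - Real.exp (-(mu / Real.pi * Real.arccos (cosAngle ra rs z / Real.cos v))))

/-- The points of the sphere of radius `rs` at distance less than `z` from the platform. -/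
def openCap (ra rs z : ℝ) : Set E3 := {x | ‖x‖ = rs ∧ dist x (northPoint ra) < z}

/-- The points of the sphere of radius `rs` at distance at most `z` from the platform. -/
def closedCap (ra rs z : ℝ) : Set E3 := {x | ‖x‖ = rs ∧ dist x (northPoint ra) ≤ z}

end

theorem measurableSet_openCap (ra rs z : ℝ) : MeasurableSet (openCap ra rs z) :=
  (measurableSet_eq_fun measurable_norm measurable_const).inter
    (measurableSet_lt (measurable_id.dist measurable_const) measurable_const)

theorem measurableSet_closedCap (ra rs z : ℝ) : MeasurableSet (closedCap ra rs z) :=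
  (measurableSet_eq_fun measurable_norm measurable_const).inter
    (measurableSet_le (measurable_id.dist measurable_const) measurable_const)

theorem norm_satPos {rs : ℝ} (hrs : 0 ≤ rs) (o : ℝ × ℝ) (w : ℝ) : ‖satPos rs o w‖ = rs := by
  rw [EuclideanSpace.norm_eq, Real.sqrt_eq_iff_mul_self_eq (by positivity) hrs, Fin.sum_univ_three]
  simp only [satPos, Real.norm_eq_abs, sq_abs, PiLp.toLp_apply, Matrix.cons_val_zero,
    Matrix.cons_val_one, Matrix.cons_val]
  have h1 := Real.sin_sq_add_cos_sq w
  have h2 := Real.sin_sq_add_cos_sq o.1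
  have h3 := Real.sin_sq_add_cos_sq o.2
  linear_combination (rs ^ 2 * Real.sin w ^ 2) * h3 + rs ^ 2 * h1 +
    rs ^ 2 * (Real.cos w ^ 2 + Real.sin w ^ 2 * Real.cos o.2 ^ 2) * h2

theorem dist_satPos_sq (rs ra : ℝ) (o : ℝ × ℝ) (w : ℝ) :
    dist (satPos rs o w) (northPoint ra) ^ 2 =
      rs ^ 2 + ra ^ 2 - 2 * rs * ra * (Real.sin w * Real.sin o.2) := by
  rw [EuclideanSpace.dist_eq, Real.sq_sqrt (by positivity), Fin.sum_univ_three]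
  simp only [satPos, northPoint, Real.dist_eq, sq_abs, PiLp.toLp_apply, Matrix.cons_val_zero,
    Matrix.cons_val_one, Matrix.cons_val]
  have h1 := Real.sin_sq_add_cos_sq w
  have h2 := Real.sin_sq_add_cos_sq o.1
  have h3 := Real.sin_sq_add_cos_sq o.2
  linear_combination (rs ^ 2 * Real.sin w ^ 2) * h3 + rs ^ 2 * h1 +
    rs ^ 2 * (Real.cos w ^ 2 + Real.sin w ^ 2 * Real.cos o.2 ^ 2) * h2

theorem dist_satPos_lt {rs ra z : ℝ} (hrs : 0 < rs) (hra : 0 < ra) (hz : 0 ≤ z) (o : ℝ × ℝ)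
    (w : ℝ) : dist (satPos rs o w) (northPoint ra) < z ↔
      cosAngle ra rs z < Real.sin w * Real.sin o.2 := by
  rw [← sq_lt_sq₀ dist_nonneg hz, dist_satPos_sq, cosAngle, div_lt_iff₀ (by positivity)]
  constructor <;> intro h <;> linarith

theorem dist_satPos_le {rs ra z : ℝ} (hrs : 0 < rs) (hra : 0 < ra) (hz : 0 ≤ z) (o : ℝ × ℝ)
    (w : ℝ) : dist (satPos rs o w) (northPoint ra) ≤ z ↔
      cosAngle ra rs z ≤ Real.sin w * Real.sin o.2 := by
  rw [← sq_le_sq₀ dist_nonneg hz, dist_satPos_sq, cosAngle, div_le_iff₀ (by positivity)]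
  constructor <;> intro h <;> linarith

/-- For 0 ≤ d ≤ 1 the superlevel set is an interval from arcsin d to π - arcsin d; for d > 1 both
sides are zero. Sandwiching `S` between the strict and the weak superlevel sets treats open and
closed caps at once. -/
theorem volume_of_sin_superlevel {d : ℝ} (hd : 0 ≤ d) {S : Set ℝ}
    (h1 : ∀ w ∈ Ico 0 (2 * Real.pi), d < Real.sin w → w ∈ S)
    (h2 : ∀ w ∈ S, w ∈ Ico 0 (2 * Real.pi) ∧ d ≤ Real.sin w) :
    volume S = ENNReal.ofReal (2 * Real.arccos d) := by
  have hpi := Real.pi_pos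
  rcases le_or_gt d 1 with hd1 | hd1
  · have ha0 : 0 ≤ Real.arcsin d := Real.arcsin_nonneg.2 hd
    have ha1 := Real.arcsin_le_pi_div_two d
    have hlen : Real.pi - Real.arcsin d - Real.arcsin d = 2 * Real.arccos d := by
      rw [Real.arccos]; ring
    apply le_antisymm
    · rw [← hlen, ← Real.volume_Icc]
      refine measure_mono fun w hw => ?_
      obtain ⟨⟨hw0, hw1⟩, hdw⟩ := h2 w hw
      have hwpi : w ≤ Real.pi := by
        by_contra! hcon
        have : 0 < Real.sin (w - Real.pi) := Real.sin_pos_of_pos_of_lt_pi (by linarith) (by linarith)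
        rw [Real.sin_sub_pi] at this
        linarith
      have hmono := Real.monotone_arcsin hdw
      rcases le_total w (Real.pi / 2) with h | h
      · rw [Real.arcsin_sin (by linarith) h] at hmono
        exact ⟨hmono, by linarith⟩
      · rw [← Real.sin_pi_sub, Real.arcsin_sin (by linarith) (by linarith)] at hmono
        exact ⟨by linarith, by linarith⟩
    · rw [← hlen, ← Real.volume_Ioo]
      refine measure_mono fun w hw => h1 w ⟨by linarith [hw.1], by linarith [hw.2]⟩ ?_
      rw [← Real.sin_arcsin (by linarith) hd1]
      rcases le_total w (Real.pi / 2) with h | h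
      · exact Real.sin_lt_sin_of_lt_of_le_pi_div_two (by linarith) h hw.1
      · rw [← Real.sin_pi_sub w]
        exact Real.sin_lt_sin_of_lt_of_le_pi_div_two (by linarith) (by linarith) (by linarith [hw.2])
  · rw [Real.arccos_of_one_le hd1.le]
    have : S = ∅ := eq_empty_of_forall_notMem fun w hw => by
      linarith [(h2 w hw).2, Real.sin_le_one w]
    simp [this]

theorem satIntensity_cap {rs ra mu z : ℝ} (hrs : 0 < rs) (hra : 0 < ra) (hmu : 0 < mu)
    (hz : 0 ≤ z) (hc : 0 ≤ cosAngle ra rs z) {o : ℝ × ℝ} (ho : o.2 ∈ Ioo 0 Real.pi) {B : Set E3}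
    (hB : MeasurableSet B) (h1 : openCap ra rs z ⊆ B) (h2 : B ⊆ closedCap ra rs z) :
    (satIntensity rs mu o B).toReal =
      mu / Real.pi * Real.arccos (cosAngle ra rs z / Real.sin o.2) := by
  have hsin : 0 < Real.sin o.2 := Real.sin_pos_of_pos_of_lt_pi ho.1 ho.2
  have hpi := Real.pi_pos
  rw [satIntensity_apply rs mu o hB, volume_of_sin_superlevel (div_nonneg hc hsin.le),
    ENNReal.toReal_mul, ENNReal.toReal_mul, ENNReal.toReal_ofReal (by positivity),
    ENNReal.toReal_ofReal hrs.le, ENNReal.toReal_ofReal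
      (mul_nonneg zero_le_two (Real.arccos_nonneg _))]
  · field_simp
  · intro w hw hlt
    rw [div_lt_iff₀ hsin] at hlt
    exact ⟨h1 ⟨norm_satPos hrs.le o w, (dist_satPos_lt hrs hra hz o w).2 hlt⟩, hw⟩
  · rintro w ⟨hwB, hw⟩
    refine ⟨hw, ?_⟩
    rw [div_le_iff₀ hsin]
    exact (dist_satPos_le hrs hra hz o w).1 (h2 hwB).2

/-- Symmetry about π/2: on either half, v = |φ - π/2| turns sin φ into cos v. -/
theorem integral_sin_eq_two_mul_integral_cos {F : ℝ → ℝ} (hF : Measurable F)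
    (h0 : ∀ s, 0 ≤ F s) (h1 : ∀ s, F s ≤ 1) :
    ∫ φ in (0 : ℝ)..Real.pi, Real.sin φ * F (Real.sin φ) =
      2 * ∫ v in (0 : ℝ)..Real.pi / 2, Real.cos v * F (Real.cos v) := by
  have hint : ∀ a b : ℝ, IntervalIntegrable (fun φ => Real.sin φ * F (Real.sin φ)) volume a b := by
    intro a b
    rw [intervalIntegrable_iff]
    refine Measure.integrableOn_of_bounded (M := 1) (by simp)
      (Measurable.aestronglyMeasurable (by fun_prop)) (ae_of_all _ fun φ => ?_)
    rw [norm_mul, Real.norm_eq_abs, Real.norm_of_nonneg (h0 _)]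
    exact mul_le_one₀ (Real.abs_sin_le_one _) (h0 _) (h1 _)
  rw [← intervalIntegral.integral_add_adjacent_intervals (hint 0 (Real.pi / 2)) (hint _ _)]
  have e1 : ∫ φ in (0 : ℝ)..Real.pi / 2, Real.sin φ * F (Real.sin φ) =
      ∫ v in (0 : ℝ)..Real.pi / 2, Real.cos v * F (Real.cos v) := by
    have := intervalIntegral.integral_comp_sub_left (a := 0) (b := Real.pi / 2)
      (fun φ => Real.sin φ * F (Real.sin φ)) (Real.pi / 2)
    simp only [Real.sin_pi_div_two_sub, sub_self, sub_zero] at this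
    exact this.symm
  have e2 : ∫ φ in (Real.pi / 2)..Real.pi, Real.sin φ * F (Real.sin φ) =
      ∫ v in (0 : ℝ)..Real.pi / 2, Real.cos v * F (Real.cos v) := by
    have := intervalIntegral.integral_comp_add_right (a := 0) (b := Real.pi / 2)
      (fun φ => Real.sin φ * F (Real.sin φ)) (Real.pi / 2)
    simp only [Real.sin_add_pi_div_two, zero_add, add_halves] at this
    exact this.symm
  rw [e1, e2]; ring

/-- The longitude contributes π and the folding of the inclination contributes 2, which cancel the
2π of the density. -/
theorem integral_orbitProcessIntensity {lam : ℝ} (hlam : 0 < lam) {F : ℝ → ℝ} (hF : Measurable F)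
    (h0 : ∀ s, 0 ≤ F s) (h1 : ∀ s, F s ≤ 1) :
    ∫ o, F (Real.sin o.2) ∂orbitProcessIntensity lam =
      lam * ∫ v in (0 : ℝ)..Real.pi / 2, Real.cos v * F (Real.cos v) := by
  have hpi := Real.pi_pos
  rw [orbitProcessIntensity, integral_withDensity_eq_integral_toReal_smul (by fun_prop)
    (ae_of_all _ fun _ => ENNReal.ofReal_lt_top), Measure.volume_eq_prod,
    ← Measure.prod_restrict]
  have hcongr : ∀ᵐ o ∂(volume.restrict (Ico 0 Real.pi)).prod (volume.restrict (Ico 0 Real.pi)),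
      (ENNReal.ofReal (lam * Real.sin o.2 / (2 * Real.pi))).toReal • F (Real.sin o.2) =
        1 * (lam / (2 * Real.pi) * (Real.sin o.2 * F (Real.sin o.2))) := by
    rw [Measure.prod_restrict]
    refine (ae_restrict_iff' (measurableSet_Ico.prod measurableSet_Ico)).2
      (ae_of_all _ fun o ho => ?_)
    have : 0 ≤ Real.sin o.2 := Real.sin_nonneg_of_nonneg_of_le_pi ho.2.1 ho.2.2.le
    rw [ENNReal.toReal_ofReal (by positivity), smul_eq_mul]
    ring
  rw [integral_congr_ae hcongr, integral_prod_mul (fun _ : ℝ => (1 : ℝ))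
    fun φ => lam / (2 * Real.pi) * (Real.sin φ * F (Real.sin φ)), integral_const_mul,
    integral_Ico_eq_integral_Ioo, ← integral_Ioc_eq_integral_Ioo,
    integral_Ico_eq_integral_Ioo, ← integral_Ioc_eq_integral_Ioo,
    ← intervalIntegral.integral_of_le hpi.le, ← intervalIntegral.integral_of_le hpi.le,
    integral_sin_eq_two_mul_integral_cos hF h0 h1]
  simp only [intervalIntegral.integral_const]
  field_simp
  simp

theorem hitProbability_mem {mu : ℝ} (hmu : 0 < mu) (d : ℝ) :
    0 ≤ 1 - Real.exp (-(mu / Real.pi * Real.arccos d)) ∧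
      1 - Real.exp (-(mu / Real.pi * Real.arccos d)) ≤ 1 := by
  have h : 0 ≤ mu / Real.pi * Real.arccos d :=
    mul_nonneg (div_pos hmu Real.pi_pos).le (Real.arccos_nonneg _)
  have h1 := Real.exp_le_one_iff.2 (neg_nonpos.2 h)
  have h2 := Real.exp_pos (-(mu / Real.pi * Real.arccos d))
  constructor <;> linarith

theorem IsSatelliteNetwork.measureReal_cap_eq_zero {Ω : Type*} [MeasurableSpace Ω] {P : Measure Ω}
    [IsProbabilityMeasure P] {ra rs lam mu z : ℝ} {Ξ : Ω → Measure (ℝ × ℝ)} {Ψ : Ω → Measure E3}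
    (h : IsSatelliteNetwork rs lam mu Ξ Ψ P) (hrs : 0 < rs) (hra : 0 < ra) (hlam : 0 < lam)
    (hmu : 0 < mu) (hz : 0 ≤ z) (hc : 0 ≤ cosAngle ra rs z) {B : Set E3}
    (hB : MeasurableSet B) (h1 : openCap ra rs z ⊆ B) (h2 : B ⊆ closedCap ra rs z) :
    P.real {ω | Ψ ω B = 0} = Real.exp (-(lam * meanHits mu ra rs z)) := by
  rw [h.measureReal_eq_zero hB, meanHits]
  congr 2
  rw [← integral_orbitProcessIntensity hlam
    (F := fun s => 1 - Real.exp (-(mu / Real.pi * Real.arccos (cosAngle ra rs z / s))))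
    (by fun_prop) (fun s => (hitProbability_mem hmu _).1) fun s => (hitProbability_mem hmu _).2]
  refine integral_congr_ae ?_
  -- The inclination φ = 0 is null and must be dropped: the arc formula divides by sin φ.
  have hne : ∀ᵐ o ∂orbitProcessIntensity lam, o.2 ∈ Ioo 0 Real.pi := by
    refine (withDensity_absolutelyContinuous _ _).ae_le ?_
    rw [Measure.volume_eq_prod, ← Measure.prod_restrict]
    refine (Measure.ae_prod_iff_ae_ae (p := fun o : ℝ × ℝ => o.2 ∈ Ioo 0 Real.pi)
      (measurable_snd measurableSet_Ioo)).2 (ae_of_all _ fun θ => ?_)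
    rw [Measure.restrict_congr_set Ioo_ae_eq_Ico.symm]
    exact ae_restrict_mem measurableSet_Ioo
  filter_upwards [hne] with o ho
  rw [satIntensity_cap hrs hra hmu hz hc ho hB h1 h2]

/-! ### From the distribution function to a density -/

noncomputable section

/-- The density in `t` of `cos v` times the probability that an orbit at angle `v` from the platform
has a satellite at distance less than `t`. -/
def hitDensity (mu ra rs t v : ℝ) : ℝ :=
  if cosAngle ra rs t < Real.cos v then
    mu * t / (Real.pi * rs * ra * Real.sqrt (1 - (cosAngle ra rs t / Real.cos v) ^ 2)) *
      Real.exp (-(mu / Real.pi * Real.arccos (cosAngle ra rs t / Real.cos v)))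
  else 0

/-- An everywhere defined measurable version of `rangeKernel`. -/
def servingKernel (lam mu ra rs t v : ℝ) : ℝ :=
  lam * Real.exp (-(lam * meanHits mu ra rs t)) * hitDensity mu ra rs t v

end

/-- The map x ↦ e^{-x} is 1-Lipschitz on [0, ∞), so the same δ works for the composition. -/
theorem absolutelyContinuousOnInterval_exp_neg {F : ℝ → ℝ} {a b : ℝ}
    (hF : AbsolutelyContinuousOnInterval F a b) (h0 : ∀ x ∈ uIcc a b, 0 ≤ F x) :
    AbsolutelyContinuousOnInterval (fun x => Real.exp (-F x)) a b := by
  have hlip : ∀ x y : ℝ, 0 ≤ x → 0 ≤ y → dist (Real.exp (-x)) (Real.exp (-y)) ≤ dist x y := by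
    have key : ∀ x y : ℝ, 0 ≤ x → x ≤ y → Real.exp (-x) - Real.exp (-y) ≤ y - x := by
      intro x y hx hxy
      have h1 : Real.exp (-y) = Real.exp (-x) * Real.exp (-(y - x)) := by
        rw [← Real.exp_add]; ring_nf
      have h2 := Real.one_sub_le_exp_neg (y - x)
      have h3 := Real.exp_le_one_iff.2 (neg_nonpos.2 hx)
      have h4 := Real.exp_pos (-x)
      rw [h1]
      nlinarith
    intro x y hx hy
    rw [Real.dist_eq, Real.dist_eq]
    rcases le_total x y with h | h
    · rw [abs_of_nonneg (sub_nonneg.2 (Real.exp_le_exp.2 (neg_le_neg h))), abs_sub_comm,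
        abs_of_nonneg (sub_nonneg.2 h)]
      exact key x y hx h
    · rw [abs_sub_comm, abs_of_nonneg (sub_nonneg.2 (Real.exp_le_exp.2 (neg_le_neg h))),
        abs_of_nonneg (sub_nonneg.2 h)]
      exact key y x hy h
  rw [absolutelyContinuousOnInterval_iff] at hF ⊢
  intro ε hε
  obtain ⟨δ, hδ, h⟩ := hF ε hε
  refine ⟨δ, hδ, fun E hE hE' => lt_of_le_of_lt (Finset.sum_le_sum fun i hi => ?_) (h E hE hE')⟩
  have hmem := hE.1 i hi
  exact hlip _ _ (h0 _ hmem.1) (h0 _ hmem.2)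

/-- With `f` merely integrable, the primitive is differentiable only almost everywhere; absolute
continuity still gives the fundamental theorem of calculus for its exponential. -/
theorem integral_mul_exp_neg_integral {f : ℝ → ℝ} {a b : ℝ} (hab : a ≤ b)
    (hf : IntervalIntegrable f volume a b) (h0 : ∀ x, 0 ≤ f x) :
    ∫ x in a..b, f x * Real.exp (-∫ y in a..x, f y) = 1 - Real.exp (-∫ y in a..b, f y) := by
  have hac := hf.absolutelyContinuousOnInterval_intervalIntegral (c := a) left_mem_uIcc
  have hE := absolutelyContinuousOnInterval_exp_neg hac fun x hx => by
    rw [uIcc_of_le hab] at hx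
    exact intervalIntegral.integral_nonneg hx.1 fun y _ => h0 y
  have h := hE.integral_deriv_eq_sub
  have h2 : ∫ x in a..b, f x * Real.exp (-∫ y in a..x, f y) =
      ∫ x in a..b, -deriv (fun x => Real.exp (-∫ y in a..x, f y)) x := by
    refine intervalIntegral.integral_congr_ae ?_
    filter_upwards [hf.ae_hasDerivAt_integral] with x hx hxm
    have : HasDerivAt (fun x => Real.exp (-∫ y in a..x, f y))
        (Real.exp (-∫ y in a..x, f y) * -f x) x :=
      (hx (uIoc_subset_uIcc hxm) a left_mem_uIcc).neg.exp
    rw [this.deriv]; ring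
  rw [h2, intervalIntegral.integral_neg, h]
  simp

theorem cosAngle_strictAnti {ra rs s t : ℝ} (hrs : 0 < rs) (hra : 0 < ra) (hs : 0 ≤ s)
    (hst : s < t) : cosAngle ra rs t < cosAngle ra rs s := by
  unfold cosAngle
  have : s ^ 2 < t ^ 2 := pow_lt_pow_left₀ hst hs two_ne_zero
  gcongr

theorem cosAngle_sub {ra rs : ℝ} (hrs : 0 < rs) (hra : 0 < ra) : cosAngle ra rs (rs - ra) = 1 := by
  unfold cosAngle
  field_simp
  ring

theorem measurable_cosAngle (ra rs : ℝ) : Measurable (cosAngle ra rs) := by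
  unfold cosAngle; fun_prop

theorem measurable_hitDensity (mu ra rs : ℝ) :
    Measurable (Function.uncurry (hitDensity mu ra rs)) := by
  have hc : Measurable fun q : ℝ × ℝ => cosAngle ra rs q.1 :=
    (measurable_cosAngle ra rs).comp measurable_fst
  unfold hitDensity Function.uncurry
  refine Measurable.ite (measurableSet_lt hc (by fun_prop)) ?_ measurable_const
  fun_prop

theorem hitDensity_nonneg {mu ra rs t : ℝ} (hrs : 0 < rs) (hra : 0 < ra) (hmu : 0 < mu)
    (ht : 0 ≤ t) (v : ℝ) : 0 ≤ hitDensity mu ra rs t v := by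
  have := Real.pi_pos
  unfold hitDensity
  split_ifs <;> positivity

theorem measurable_meanHits (mu ra rs : ℝ) : Measurable (meanHits mu ra rs) := by
  have hc : Measurable fun q : ℝ × ℝ => cosAngle ra rs q.1 :=
    (measurable_cosAngle ra rs).comp measurable_fst
  have hm : Measurable fun q : ℝ × ℝ => Real.cos q.2 * (1 - Real.exp (-(mu / Real.pi *
      Real.arccos (cosAngle ra rs q.1 / Real.cos q.2)))) := by
    fun_prop
  unfold meanHits
  simp_rw [intervalIntegral.integral_of_le Real.pi_div_two_pos.le]
  exact (hm.stronglyMeasurable.integral_prod_right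
    (ν := volume.restrict (Ioc 0 (Real.pi / 2)))).measurable

theorem measurable_servingKernel (lam mu ra rs : ℝ) :
    Measurable (Function.uncurry (servingKernel lam mu ra rs)) := by
  have h1 : Measurable fun q : ℝ × ℝ => meanHits mu ra rs q.1 :=
    (measurable_meanHits mu ra rs).comp measurable_fst
  have h2 := measurable_hitDensity mu ra rs
  unfold Function.uncurry at h2 ⊢
  unfold servingKernel
  fun_prop

/-- The outer factor cos v cancels the 1 / cos v of the inner derivative, which is why `hitDensity`
carries no such factor. -/
theorem hasDerivAt_hitProbability {mu ra rs t v : ℝ} (hrs : 0 < rs) (hra : 0 < ra)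
    (hv : 0 < Real.cos v) (h0 : 0 ≤ cosAngle ra rs t) (h1 : cosAngle ra rs t < Real.cos v) :
    HasDerivAt (fun t => Real.cos v *
      (1 - Real.exp (-(mu / Real.pi * Real.arccos (cosAngle ra rs t / Real.cos v)))))
      (hitDensity mu ra rs t v) t := by
  have hd0 : 0 ≤ cosAngle ra rs t / Real.cos v := div_nonneg h0 hv.le
  have hd1 : cosAngle ra rs t / Real.cos v < 1 := (div_lt_one hv).2 h1
  have hc : HasDerivAt (fun t => cosAngle ra rs t / Real.cos v)
      (-(2 * t) / (2 * rs * ra) / Real.cos v) t := by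
    unfold cosAngle
    have := (((hasDerivAt_pow 2 t).const_sub (rs ^ 2 + ra ^ 2)).div_const (2 * rs * ra)).div_const
      (Real.cos v)
    simpa using this
  have ha := (Real.hasDerivAt_arccos (by linarith) hd1.ne).comp t hc
  have := ((((ha.const_mul (mu / Real.pi)).neg).exp.const_sub 1).const_mul (Real.cos v))
  refine this.congr_deriv ?_
  have hroot : 0 < Real.sqrt (1 - (cosAngle ra rs t / Real.cos v) ^ 2) :=
    Real.sqrt_pos.2 (by nlinarith)
  have hpi := Real.pi_pos
  rw [hitDensity, if_pos h1]
  simp only [Function.comp_apply, Pi.neg_apply]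
  field_simp

theorem continuous_hitProbability (mu ra rs v : ℝ) :
    Continuous fun t => Real.cos v *
      (1 - Real.exp (-(mu / Real.pi * Real.arccos (cosAngle ra rs t / Real.cos v)))) := by
  have : Continuous (cosAngle ra rs) := by unfold cosAngle; fun_prop
  have h2 : Continuous fun t => Real.arccos (cosAngle ra rs t / Real.cos v) :=
    Real.continuous_arccos.comp (this.div_const _)
  fun_prop

/-- For fixed v the growing cap first touches the orbit at a distance s. The density vanishes before
s; after s the fundamental theorem of calculus applies, starting from the value arccos 1 = 0. -/
theorem lintegral_hitDensity_left {mu ra rs z v : ℝ} (hra : 0 < ra) (hrs : ra < rs) (hmu : 0 < mu)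
    (hz : rs - ra ≤ z) (hc : 0 ≤ cosAngle ra rs z) (hv : v ∈ Ioo 0 (Real.pi / 2)) :
    ∫⁻ t in Ioo (rs - ra) z, ENNReal.ofReal (hitDensity mu ra rs t v) =
      ENNReal.ofReal (Real.cos v *
        (1 - Real.exp (-(mu / Real.pi * Real.arccos (cosAngle ra rs z / Real.cos v))))) := by
  have hrs0 : 0 < rs := hra.trans hrs
  have hcv : 0 < Real.cos v := Real.cos_pos_of_mem_Ioo ⟨by linarith [hv.1, Real.pi_pos], hv.2⟩
  have hcv1 : Real.cos v < 1 := by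
    rw [← Real.cos_zero]
    exact Real.cos_lt_cos_of_nonneg_of_le_pi_div_two le_rfl hv.2.le hv.1
  rcases le_or_gt (Real.cos v) (cosAngle ra rs z) with h | h
  · rw [Real.arccos_of_one_le ((one_le_div hcv).2 h)]
    simp only [mul_zero, neg_zero, Real.exp_zero, sub_self, ENNReal.ofReal_zero]
    rw [setLIntegral_congr_fun (g := fun _ => 0) measurableSet_Ioo]
    · simp
    · intro t ht
      have := cosAngle_strictAnti hrs0 hra (by linarith [ht.1] : 0 ≤ t) ht.2
      simp [hitDensity, (h.trans this.le).not_gt]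
  -- By the law of cosines, s solves `cosAngle ra rs s = cos v`.
  · set s := Real.sqrt (rs ^ 2 + ra ^ 2 - 2 * rs * ra * Real.cos v) with hs
    have hpos : 0 ≤ rs ^ 2 + ra ^ 2 - 2 * rs * ra * Real.cos v := by
      have : 0 < rs * ra := mul_pos hrs0 hra
      nlinarith [sq_nonneg (rs - ra)]
    have hs0 : 0 ≤ s := Real.sqrt_nonneg _
    have hcs : cosAngle ra rs s = Real.cos v := by
      rw [cosAngle, hs, Real.sq_sqrt hpos]
      field_simp
      ring
    have has : rs - ra ≤ s := by
      by_contra! hcon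
      have := cosAngle_strictAnti hrs0 hra hs0 hcon
      rw [cosAngle_sub hrs0 hra, hcs] at this
      linarith
    have hsz : s ≤ z := by
      by_contra! hcon
      have := cosAngle_strictAnti hrs0 hra (by linarith) hcon
      rw [hcs] at this
      linarith
    have hsub : Ioo s z ⊆ Ioo (rs - ra) z := Ioo_subset_Ioo_left has
    have hlt : ∀ t ∈ Ioo s z, 0 ≤ cosAngle ra rs t ∧ cosAngle ra rs t < Real.cos v := by
      intro t ht
      refine ⟨hc.trans (cosAngle_strictAnti hrs0 hra (hs0.trans ht.1.le) ht.2).le, ?_⟩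
      rw [← hcs]
      exact cosAngle_strictAnti hrs0 hra hs0 ht.1
    have hderiv : ∀ t ∈ Ioo s z, HasDerivAt (fun t => Real.cos v *
        (1 - Real.exp (-(mu / Real.pi * Real.arccos (cosAngle ra rs t / Real.cos v)))))
        (hitDensity mu ra rs t v) t := fun t ht =>
      hasDerivAt_hitProbability hrs0 hra hcv (hlt t ht).1 (hlt t ht).2
    have hnn : ∀ t ∈ Ioo s z, 0 ≤ hitDensity mu ra rs t v := fun t ht =>
      hitDensity_nonneg hrs0 hra hmu (hs0.trans ht.1.le) v
    have hcont := (continuous_hitProbability mu ra rs v).continuousOn (s := Icc s z)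
    -- The derivative is singular at s, but a nonnegative derivative of a function continuous up to
    -- the endpoints is integrable.
    have hint := intervalIntegral.integrableOn_deriv_of_nonneg hcont hderiv hnn
    have hftc := intervalIntegral.integral_eq_sub_of_hasDerivAt_of_le hsz hcont hderiv
      ((intervalIntegrable_iff_integrableOn_Ioc_of_le hsz).2 hint)
    rw [hcs, div_self hcv.ne', Real.arccos_one] at hftc
    simp only [mul_zero, neg_zero, Real.exp_zero, sub_self, sub_zero] at hftc
    rw [← hftc, intervalIntegral.integral_of_le hsz, integral_Ioc_eq_integral_Ioo,
      ofReal_integral_eq_lintegral_ofReal (hint.mono_set Ioo_subset_Ioc_self)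
        ((ae_restrict_iff' measurableSet_Ioo).2 (ae_of_all _ hnn))]
    rw [← lintegral_indicator measurableSet_Ioo, ← lintegral_indicator measurableSet_Ioo]
    refine lintegral_congr fun t => ?_
    by_cases hts : t ∈ Ioo s z
    · rw [indicator_of_mem (hsub hts), indicator_of_mem hts]
    rw [indicator_of_notMem hts]
    refine indicator_apply_eq_zero.2 fun ht => ?_
    have hle : t ≤ s := by
      by_contra! hcon
      exact hts ⟨hcon, ht.2⟩
    have : Real.cos v ≤ cosAngle ra rs t := by
      rcases hle.eq_or_lt with e | e
      · rw [e, hcs]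
      · rw [← hcs]
        exact (cosAngle_strictAnti hrs0 hra (by linarith [ht.1]) e).le
    simp [hitDensity, this.not_gt]

/-- Tonelli swaps the t and v integrals, so no differentiation under the integral sign is needed. -/
theorem ofReal_meanHits {mu ra rs z : ℝ} (hra : 0 < ra) (hrs : ra < rs) (hmu : 0 < mu)
    (hz : rs - ra ≤ z) (hc : 0 ≤ cosAngle ra rs z) :
    ENNReal.ofReal (meanHits mu ra rs z) = ∫⁻ t in Ioo (rs - ra) z,
      ∫⁻ v in Ioo 0 (Real.pi / 2), ENNReal.ofReal (hitDensity mu ra rs t v) := by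
  have hcos : ∀ v ∈ Ioo 0 (Real.pi / 2), 0 < Real.cos v := fun v hv =>
    Real.cos_pos_of_mem_Ioo ⟨by linarith [hv.1, Real.pi_pos], hv.2⟩
  rw [meanHits, intervalIntegral.integral_of_le Real.pi_div_two_pos.le,
    integral_Ioc_eq_integral_Ioo, ofReal_integral_eq_lintegral_ofReal]
  · rw [lintegral_lintegral_swap (by
      have := (measurable_hitDensity mu ra rs).ennreal_ofReal
      exact this.aemeasurable)]
    refine setLIntegral_congr_fun measurableSet_Ioo fun v hv => ?_
    exact (lintegral_hitDensity_left hra hrs hmu hz hc hv).symm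
  · refine Measure.integrableOn_of_bounded (M := 1) (by simp)
      (Measurable.aestronglyMeasurable (by fun_prop)) (ae_of_all _ fun v => ?_)
    have h := hitProbability_mem hmu (cosAngle ra rs z / Real.cos v)
    rw [norm_mul, Real.norm_eq_abs, Real.norm_of_nonneg h.1]
    exact mul_le_one₀ (Real.abs_cos_le_one _) h.1 h.2
  · refine (ae_restrict_iff' measurableSet_Ioo).2 (ae_of_all _ fun v hv => ?_)
    exact mul_nonneg (hcos v hv).le (hitProbability_mem hmu _).1

theorem meanHits_nonneg {mu : ℝ} (hmu : 0 < mu) (ra rs z : ℝ) : 0 ≤ meanHits mu ra rs z := by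
  refine intervalIntegral.integral_nonneg Real.pi_div_two_pos.le fun v hv => ?_
  exact mul_nonneg (Real.cos_nonneg_of_mem_Icc ⟨by linarith [hv.1, Real.pi_pos], hv.2⟩)
    (hitProbability_mem hmu _).1

/-- The v-integral of the kernel at t is λ J'(t) exp(-λ J(t)) for almost every t, the derivative of
1 - exp(-λ J), where J = `meanHits`. -/
theorem lintegral_servingKernel {lam mu ra rs z : ℝ} (hra : 0 < ra) (hrs : ra < rs)
    (hlam : 0 < lam) (hmu : 0 < mu) (hz : rs - ra ≤ z) (hc : 0 ≤ cosAngle ra rs z) :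
    ∫⁻ t in Ioo (rs - ra) z,
      ∫⁻ v in Ioo 0 (Real.pi / 2), ENNReal.ofReal (servingKernel lam mu ra rs t v) =
      ENNReal.ofReal (1 - Real.exp (-(lam * meanHits mu ra rs z))) := by
  have hrs0 : 0 < rs := hra.trans hrs
  let h : ℝ → ℝ≥0∞ := fun t =>
    ∫⁻ v in Ioo 0 (Real.pi / 2), ENNReal.ofReal (hitDensity mu ra rs t v)
  have hm : Measurable h :=
    (measurable_hitDensity mu ra rs).ennreal_ofReal.lintegral_prod_right'
  have hJ : ∀ t ∈ Icc (rs - ra) z,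
      ENNReal.ofReal (meanHits mu ra rs t) = ∫⁻ s in Ioo (rs - ra) t, h s := by
    intro t ht
    refine ofReal_meanHits hra hrs hmu ht.1 ?_
    rcases ht.2.eq_or_lt with e | e
    · rwa [e]
    · exact hc.trans (cosAngle_strictAnti hrs0 hra (by linarith [ht.1]) e).le
  have hfin : ∫⁻ s in Ioo (rs - ra) z, h s ≠ ∞ := by
    rw [← hJ z ⟨hz, le_rfl⟩]; exact ENNReal.ofReal_ne_top
  -- Finiteness of the inner integral is known only for almost every t, from finiteness of J(z);
  -- this suffices to pass to the real function `f`.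
  have hae : ∀ᵐ t ∂volume.restrict (Ioo (rs - ra) z), h t < ∞ := ae_lt_top hm hfin
  let f : ℝ → ℝ := fun t => lam * (h t).toReal
  have hint : IntegrableOn f (Ioo (rs - ra) z) := (integrable_toReal_of_lintegral_ne_top
    hm.aemeasurable hfin).const_mul lam
  have hf0 : ∀ t, 0 ≤ f t := fun t => mul_nonneg hlam.le ENNReal.toReal_nonneg
  have hF : ∀ t ∈ Icc (rs - ra) z, ∫ s in (rs - ra)..t, f s = lam * meanHits mu ra rs t := by
    intro t ht
    rw [intervalIntegral.integral_const_mul, intervalIntegral.integral_of_le ht.1,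
      integral_Ioc_eq_integral_Ioo, integral_toReal hm.aemeasurable
        (ae_restrict_of_ae_restrict_of_subset (Ioo_subset_Ioo_right ht.2) hae), ← hJ t ht,
      ENNReal.toReal_ofReal (meanHits_nonneg hmu _ _ _)]
  have key := integral_mul_exp_neg_integral hz
    ((intervalIntegrable_iff_integrableOn_Ioo_of_le hz).2 hint) hf0
  rw [hF z ⟨hz, le_rfl⟩, intervalIntegral.integral_of_le hz, integral_Ioc_eq_integral_Ioo] at key
  have key2 : ∫ t in Ioo (rs - ra) z, f t * Real.exp (-(lam * meanHits mu ra rs t)) =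
      1 - Real.exp (-(lam * meanHits mu ra rs z)) := by
    rw [← key]
    refine setIntegral_congr_fun measurableSet_Ioo fun t ht => ?_
    rw [hF t ⟨ht.1.le, ht.2.le⟩]
  have hint2 : IntegrableOn (fun t => f t * Real.exp (-(lam * meanHits mu ra rs t)))
      (Ioo (rs - ra) z) := by
    refine Integrable.mul_bdd (c := 1) hint ?_ (ae_of_all _ fun t => ?_)
    · have := measurable_meanHits mu ra rs
      exact Measurable.aestronglyMeasurable (by fun_prop)
    · rw [Real.norm_of_nonneg (Real.exp_nonneg _), Real.exp_le_one_iff, neg_nonpos]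
      exact mul_nonneg hlam.le (meanHits_nonneg hmu _ _ _)
  rw [← key2, ofReal_integral_eq_lintegral_ofReal hint2
    (ae_of_all _ fun t => mul_nonneg (hf0 t) (Real.exp_nonneg _))]
  refine lintegral_congr_ae ?_
  filter_upwards [hae] with t ht
  have hk : ∀ v, ENNReal.ofReal (servingKernel lam mu ra rs t v) =
      ENNReal.ofReal (lam * Real.exp (-(lam * meanHits mu ra rs t))) *
        ENNReal.ofReal (hitDensity mu ra rs t v) := fun v =>
    ENNReal.ofReal_mul (mul_nonneg hlam.le (Real.exp_nonneg _))
  simp_rw [hk]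
  rw [lintegral_const_mul _ (by
    exact ((measurable_hitDensity mu ra rs).of_uncurry_left (x := t)).ennreal_ofReal)]
  change _ * h t = _
  rw [← ENNReal.ofReal_toReal ht.ne, ← ENNReal.ofReal_mul
    (mul_nonneg hlam.le (Real.exp_nonneg _))]
  congr 1
  simp only [f]
  ring

/-! ### Agreement with the closed-form kernel -/

theorem cos_zeta {ra rs z : ℝ} (h0 : 0 ≤ cosAngle ra rs z) (h1 : cosAngle ra rs z ≤ 1) :
    Real.cos (zeta ra rs z) = cosAngle ra rs z := by
  rw [zeta]
  exact Real.cos_arccos (by unfold cosAngle at h0; linarith) h1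

theorem zeta_nonneg (ra rs z : ℝ) : 0 ≤ zeta ra rs z := Real.arccos_nonneg _

theorem zeta_le {ra rs z : ℝ} (h0 : 0 ≤ cosAngle ra rs z) : zeta ra rs z ≤ Real.pi / 2 :=
  Real.arccos_le_pi_div_two.2 h0

theorem arcsin_root {ra rs z v : ℝ} (h0 : 0 ≤ cosAngle ra rs z) (h1 : cosAngle ra rs z ≤ 1)
    (hv : v ∈ Icc 0 (Real.pi / 2)) :
    Real.arcsin (root ra rs z v) = Real.arccos (cosAngle ra rs z / Real.cos v) := by
  rw [root, cos_zeta h0 h1, Real.arccos_eq_arcsin, div_pow]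
  exact div_nonneg h0 (Real.cos_nonneg_of_mem_Icc ⟨by linarith [hv.1, Real.pi_pos], hv.2⟩)

theorem cos_le_cosAngle {ra rs z v : ℝ} (h0 : 0 ≤ cosAngle ra rs z) (h1 : cosAngle ra rs z ≤ 1)
    (hv1 : zeta ra rs z ≤ v) (hv2 : v ≤ Real.pi / 2) : Real.cos v ≤ cosAngle ra rs z := by
  rw [← cos_zeta h0 h1]
  exact Real.cos_le_cos_of_nonneg_of_le_pi (zeta_nonneg _ _ _) (by linarith [Real.pi_pos]) hv1

/-- Orbits with w ≥ ζ(z) miss the open cap: the arccosine is 0 there, so the upper limit may be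
moved to π/2. -/
theorem integral_zeta_eq_meanHits {mu ra rs z : ℝ} (h0 : 0 ≤ cosAngle ra rs z)
    (h1 : cosAngle ra rs z ≤ 1) :
    ∫ w in (0 : ℝ)..zeta ra rs z,
      Real.cos w * (1 - Real.exp (-(mu / Real.pi) * Real.arcsin (root ra rs z w))) =
      meanHits mu ra rs z := by
  have hz := zeta_le h0
  rw [meanHits, intervalIntegral.integral_of_le (zeta_nonneg _ _ _),
    intervalIntegral.integral_of_le Real.pi_div_two_pos.le]
  symm
  rw [setIntegral_eq_of_subset_of_forall_sdiff_eq_zero measurableSet_Ioc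
    (Ioc_subset_Ioc_right hz)]
  · refine setIntegral_congr_fun measurableSet_Ioc fun w hw => ?_
    rw [arcsin_root h0 h1 ⟨hw.1.le, hw.2.trans hz⟩, neg_mul]
  · intro w hw
    have hzw : zeta ra rs z ≤ w := by
      by_contra! hcon
      exact hw.2 ⟨hw.1.1, hcon.le⟩
    -- At w = π/2 the quotient is a division by zero, but the prefactor cos w vanishes.
    rcases hw.1.2.eq_or_lt with e | e
    · rw [e, Real.cos_pi_div_two, zero_mul]
    · have hcw : 0 < Real.cos w := Real.cos_pos_of_mem_Ioo ⟨by linarith [hw.1.1, Real.pi_pos], e⟩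
      rw [Real.arccos_of_one_le ((one_le_div hcw).2 (cos_le_cosAngle h0 h1 hzw hw.1.2))]
      simp

theorem rangeKernel_eq_servingKernel {lam mu ra rs z v : ℝ} (h0 : 0 ≤ cosAngle ra rs z)
    (h1 : cosAngle ra rs z ≤ 1) (hv : v ∈ Ioo 0 (zeta ra rs z)) :
    rangeKernel lam mu ra rs z v = servingKernel lam mu ra rs z v := by
  have hz := zeta_le h0
  have hlt : cosAngle ra rs z < Real.cos v := by
    rw [← cos_zeta h0 h1]
    exact Real.cos_lt_cos_of_nonneg_of_le_pi hv.1.le (by linarith [Real.pi_pos]) hv.2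
  rw [rangeKernel, integral_zeta_eq_meanHits h0 h1, arcsin_root h0 h1 ⟨hv.1.le, hv.2.le.trans hz⟩,
    servingKernel, hitDensity, if_pos hlt, root, cos_zeta h0 h1, div_pow, sub_eq_add_neg,
    Real.exp_add, neg_mul]
  ring

/-- Replaces the moving interval (0, ζ(z)) by the fixed interval (0, π/2) on which Tonelli was
applied. -/
theorem servingKernel_eq_zero {lam mu ra rs z v : ℝ} (h0 : 0 ≤ cosAngle ra rs z)
    (h1 : cosAngle ra rs z ≤ 1) (hv1 : zeta ra rs z ≤ v) (hv2 : v ≤ Real.pi / 2) :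
    servingKernel lam mu ra rs z v = 0 := by
  rw [servingKernel, hitDensity, if_neg (cos_le_cosAngle h0 h1 hv1 hv2).not_gt, mul_zero]

/-! ### The serving distance as a measurable functional of the satellites -/

noncomputable section

/-- The density at `t` of the distance to the serving satellite, as an extended real. -/
def servingDensity (lam mu ra rs t : ℝ) : ℝ≥0∞ :=
  ∫⁻ v in Ioo 0 (Real.pi / 2), ENNReal.ofReal (servingKernel lam mu ra rs t v)

open Classical in
/-- A measurable function of the satellite configuration that agrees with `servingDist` on counting
measures. -/
def countingServingDist (re ra rs : ℝ) (m : Measure E3) : ℝ≥0∞ :=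
  ⨅ q : ℚ, if m (extendedCap re ra rs ∩ openCap ra rs q) = 0 then ∞ else ENNReal.ofReal q

end

/-- A sum of Dirac masses charges a measurable set exactly when one of its atoms lies there. This
links `servingDist`, defined through atoms, to the counts governed by the process laws. -/
theorem IsCountingMeasure.apply_ne_zero_iff {X : Type*} [MeasurableSpace X]
    [MeasurableSingletonClass X] {m : Measure X} (hm : IsCountingMeasure m) {B : Set X}
    (hB : MeasurableSet B) : m B ≠ 0 ↔ (points m ∩ B).Nonempty := by
  obtain ⟨s, x, rfl⟩ := hm
  have key : ∀ C : Set X, MeasurableSet C →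
      ((Measure.sum fun i => Measure.dirac (x i)) C ≠ 0 ↔ ∃ i, x i ∈ C) := by
    intro C hC
    rw [Measure.sum_apply _ hC, Ne, ENNReal.tsum_eq_zero]
    simp [Measure.dirac_apply' _ hC]
  rw [key B hB]
  constructor
  · rintro ⟨i, hi⟩
    exact ⟨x i, (key _ (measurableSet_singleton _)).2 ⟨i, rfl⟩, hi⟩
  · rintro ⟨y, hy, hyB⟩
    obtain ⟨i, hi⟩ := (key _ (measurableSet_singleton _)).1 hy
    exact ⟨i, by rwa [mem_singleton_iff.1 hi]⟩

theorem measurableSet_extendedCap (re ra rs : ℝ) : MeasurableSet (extendedCap re ra rs) :=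
  measurableSet_closedCap ra rs (rimDist re ra rs)

theorem measurable_countingServingDist (re ra rs : ℝ) :
    Measurable (countingServingDist re ra rs) := by
  unfold countingServingDist
  refine Measurable.iInf fun q => Measurable.ite ?_ measurable_const measurable_const
  exact Measure.measurable_coe ((measurableSet_extendedCap re ra rs).inter
    (measurableSet_openCap ra rs q)) (measurableSet_singleton 0)

section

variable {re ra rs : ℝ} {m : Measure E3}

theorem servingDist_lt_iff {r : ℝ≥0∞} : servingDist re ra rs m < r ↔
    ∃ y ∈ points m ∩ extendedCap re ra rs, edist y (northPoint ra) < r := by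
  rw [servingDist, Metric.infEDist_lt_iff]
  simp_rw [edist_comm]

/-- A rational fits strictly between the distance of a satellite and any larger bound, so countably
many cap counts determine the infimum. -/
theorem servingDist_eq_countingServingDist (hm : IsCountingMeasure m) :
    servingDist re ra rs m = countingServingDist re ra rs m := by
  have hB : ∀ q : ℚ, MeasurableSet (extendedCap re ra rs ∩ openCap ra rs q) := fun q =>
    (measurableSet_extendedCap re ra rs).inter (measurableSet_openCap ra rs q)
  apply le_antisymm
  · refine le_iInf fun q => ?_
    split_ifs with h
    · exact le_top
    · obtain ⟨y, hy, hyc, hyo⟩ := (hm.apply_ne_zero_iff (hB q)).1 h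
      exact (servingDist_lt_iff.2 ⟨y, ⟨hy, hyc⟩, edist_lt_ofReal.2 hyo.2⟩).le
  · refine le_of_forall_gt fun r hr => ?_
    obtain ⟨y, ⟨hy, hyc⟩, hyr⟩ := servingDist_lt_iff.1 hr
    obtain ⟨q, -, hq1, hq2⟩ := ENNReal.lt_iff_exists_rat_btwn.1 hyr
    refine lt_of_le_of_lt (iInf_le _ q) ?_
    have hne : m (extendedCap re ra rs ∩ openCap ra rs q) ≠ 0 :=
      (hm.apply_ne_zero_iff (hB q)).2 ⟨y, hy, hyc, hyc.1, edist_lt_ofReal.1 hq1⟩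
    rw [if_neg hne]
    exact hq2

/-- Up to the rim, the open cap lies inside the extended cap, so visibility imposes no further
restriction. -/
theorem servingDist_lt_ofReal_iff (hm : IsCountingMeasure m) {z : ℝ} (hz : z ≤ rimDist re ra rs) :
    servingDist re ra rs m < ENNReal.ofReal z ↔ m (openCap ra rs z) ≠ 0 := by
  rw [hm.apply_ne_zero_iff (measurableSet_openCap ra rs z), servingDist_lt_iff]
  constructor
  · rintro ⟨y, ⟨hy, hyc⟩, h⟩
    exact ⟨y, hy, hyc.1, edist_lt_ofReal.1 h⟩
  · rintro ⟨y, hy, hyc, h⟩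
    exact ⟨y, ⟨hy, hyc, h.le.trans hz⟩, edist_lt_ofReal.2 h⟩

theorem servingDist_ne_top_iff (hm : IsCountingMeasure m) :
    servingDist re ra rs m ≠ ∞ ↔ m (extendedCap re ra rs) ≠ 0 := by
  rw [hm.apply_ne_zero_iff (measurableSet_extendedCap re ra rs), ← lt_top_iff_ne_top,
    servingDist_lt_iff]
  exact ⟨fun ⟨y, hy, _⟩ => ⟨y, hy⟩, fun ⟨y, hy⟩ => ⟨y, hy, edist_lt_top _ _⟩⟩

theorem servingDist_le_of_ne_top (h : servingDist re ra rs m ≠ ∞) :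
    servingDist re ra rs m ≤ ENNReal.ofReal (rimDist re ra rs) := by
  obtain ⟨y, hy, -⟩ := servingDist_lt_iff.1 (lt_top_iff_ne_top.2 h)
  refine (Metric.infEDist_le_edist_of_mem hy).trans ?_
  rw [edist_comm, edist_dist]
  exact ENNReal.ofReal_le_ofReal hy.2.2

theorem norm_northPoint {r : ℝ} (hr : 0 ≤ r) : ‖northPoint r‖ = r := by
  rw [EuclideanSpace.norm_eq, Fin.sum_univ_three]
  simp [northPoint, Real.sqrt_sq hr]

theorem ofReal_sub_le_servingDist (hra : 0 ≤ ra) :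
    ENNReal.ofReal (rs - ra) ≤ servingDist re ra rs m := by
  refine Metric.le_infEDist.2 fun y hy => ?_
  rw [edist_comm, edist_dist]
  refine ENNReal.ofReal_le_ofReal ?_
  have := norm_sub_norm_le y (northPoint ra)
  rw [hy.2.1, norm_northPoint hra] at this
  rwa [dist_eq_norm]

end

/-! ### Bounds at the rim of the visible cap -/

section

variable {re ra rs : ℝ}

theorem capAngle_pos (hre : 0 < re) (hra : re < ra) : 0 < capAngle re ra rs :=
  add_pos_of_pos_of_nonneg (Real.arccos_pos.2 ((div_lt_one (hre.trans hra)).2 hra))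
    (Real.arccos_nonneg _)

theorem rimDist_sq (hra : 0 < ra) (hrs : 0 < rs) : rimDist re ra rs ^ 2 =
    rs ^ 2 + ra ^ 2 - 2 * rs * ra * Real.cos (capAngle re ra rs) := by
  refine Real.sq_sqrt ?_
  have : 0 < rs * ra := mul_pos hrs hra
  nlinarith [sq_nonneg (rs - ra), Real.cos_le_one (capAngle re ra rs)]

theorem cosAngle_rimDist (hra : 0 < ra) (hrs : 0 < rs) :
    cosAngle ra rs (rimDist re ra rs) = Real.cos (capAngle re ra rs) := by
  rw [cosAngle, rimDist_sq hra hrs]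
  field_simp
  ring

/-- The bound π/2 on the cap angle becomes the sign condition on which the arc formula and the
density computation rest; by monotonicity it passes to all smaller distances. -/
theorem cosAngle_rimDist_nonneg (hre : 0 < re) (hra : re < ra) (hrs : 0 < rs)
    (hcap : capAngle re ra rs ≤ Real.pi / 2) : 0 ≤ cosAngle ra rs (rimDist re ra rs) := by
  rw [cosAngle_rimDist (hre.trans hra) hrs]
  exact Real.cos_nonneg_of_mem_Icc ⟨by linarith [capAngle_pos (rs := rs) hre hra, Real.pi_pos], hcap⟩

theorem sub_lt_rimDist (hre : 0 < re) (hra : re < ra) (hrs : 0 < rs)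
    (hcap : capAngle re ra rs ≤ Real.pi / 2) : rs - ra < rimDist re ra rs := by
  have h0 : 0 ≤ rimDist re ra rs := Real.sqrt_nonneg _
  refine lt_of_pow_lt_pow_left₀ 2 h0 ?_
  rw [rimDist_sq (hre.trans hra) hrs]
  have hlt : Real.cos (capAngle re ra rs) < 1 := by
    rw [← Real.cos_zero]
    exact Real.cos_lt_cos_of_nonneg_of_le_pi_div_two le_rfl hcap (capAngle_pos hre hra)
  have : 0 < rs * ra := mul_pos hrs (hre.trans hra)
  nlinarith

theorem cosAngle_mem (hre : 0 < re) (hra : re < ra) (hrs : ra < rs)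
    (hcap : capAngle re ra rs ≤ Real.pi / 2) {z : ℝ} (hz : z ∈ Icc (rs - ra) (rimDist re ra rs)) :
    cosAngle ra rs z ∈ Icc 0 1 := by
  have hra0 := hre.trans hra
  have hrs0 := hra0.trans hrs
  constructor
  · have h := cosAngle_rimDist_nonneg hre hra hrs0 hcap
    rcases hz.2.eq_or_lt with e | e
    · rwa [e]
    · exact h.trans (cosAngle_strictAnti hrs0 hra0 (by linarith [hz.1]) e).le
  · rw [← cosAngle_sub hrs0 hra0]
    rcases hz.1.eq_or_lt with e | e
    · rw [e]
    · exact (cosAngle_strictAnti hrs0 hra0 (by linarith) e).le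

end

/-! ### Law of the serving distance -/

section

variable {Ω : Type*} [MeasurableSpace Ω] {P : Measure Ω} [IsProbabilityMeasure P]
  {re ra rs lam mu : ℝ} {Ξ : Ω → Measure (ℝ × ℝ)} {Ψ : Ω → Measure E3}

theorem measurable_servingDensity (lam mu ra rs : ℝ) : Measurable (servingDensity lam mu ra rs) :=
  (measurable_servingKernel lam mu ra rs).ennreal_ofReal.lintegral_prod_right'

theorem IsSatelliteNetwork.measure_ne_zero (h : IsSatelliteNetwork rs lam mu Ξ Ψ P)
    (hrs : 0 < rs) (hra : 0 < ra) (hlam : 0 < lam) (hmu : 0 < mu) {z : ℝ} (hz : 0 ≤ z)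
    (hc : 0 ≤ cosAngle ra rs z) {B : Set E3} (hB : MeasurableSet B) (h1 : openCap ra rs z ⊆ B)
    (h2 : B ⊆ closedCap ra rs z) :
    P {ω | Ψ ω B ≠ 0} = ENNReal.ofReal (1 - Real.exp (-(lam * meanHits mu ra rs z))) := by
  have hm : MeasurableSet {ω | Ψ ω B = 0} :=
    (Measure.measurable_coe hB).comp h.satellites.measurable (measurableSet_singleton 0)
  rw [← h.measureReal_cap_eq_zero hrs hra hlam hmu hz hc hB h1 h2, ← probReal_compl_eq_one_sub hm,
    ofReal_measureReal]
  rfl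

/-- The law of the distance to the serving satellite. -/
theorem IsSatelliteNetwork.map_countingServingDist (h : IsSatelliteNetwork rs lam mu Ξ Ψ P)
    (hre : 0 < re) (hra : re < ra) (hrs : ra < rs) (hcap : capAngle re ra rs ≤ Real.pi / 2)
    (hlam : 0 < lam) (hmu : 0 < mu) :
    (P.restrict {ω | countingServingDist re ra rs (Ψ ω) ≠ ∞}).map
        (fun ω => (countingServingDist re ra rs (Ψ ω)).toReal) =
      (volume.restrict (Ioo (rs - ra) (rimDist re ra rs))).withDensity
        (servingDensity lam mu ra rs) := by
  have hra0 := hre.trans hra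
  have hrs0 := hra0.trans hrs
  have hlt := sub_lt_rimDist hre hra hrs0 hcap
  have hD : Measurable fun ω => countingServingDist re ra rs (Ψ ω) :=
    (measurable_countingServingDist re ra rs).comp h.satellites.measurable
  have hcount := h.satellites.counting
  set μD := (P.restrict {ω | countingServingDist re ra rs (Ψ ω) ≠ ∞}).map
    (fun ω => (countingServingDist re ra rs (Ψ ω)).toReal) with hμD
  set ρ := (volume.restrict (Ioo (rs - ra) (rimDist re ra rs))).withDensity
    (servingDensity lam mu ra rs) with hρ
  have hμ : ∀ B, MeasurableSet B → μD B = P {ω | servingDist re ra rs (Ψ ω) ≠ ∞ ∧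
      (servingDist re ra rs (Ψ ω)).toReal ∈ B} := by
    intro B hB
    rw [hμD, Measure.map_apply hD.ennreal_toReal hB, Measure.restrict_apply
      (hD.ennreal_toReal hB)]
    refine measure_congr ?_
    filter_upwards [hcount] with ω hω
    refine propext ?_
    change (_ ∈ B ∧ _ ≠ ∞) ↔ (_ ≠ ∞ ∧ _ ∈ B)
    rw [servingDist_eq_countingServingDist hω, and_comm]
  have hρ' : ∀ B, MeasurableSet B →
      ρ B = ∫⁻ t in B ∩ Ioo (rs - ra) (rimDist re ra rs), servingDensity lam mu ra rs t := by
    intro B hB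
    rw [hρ, withDensity_apply _ hB, Measure.restrict_restrict hB]
  -- The total mass involves the closed extended cap, whereas half-lines involve open caps; the void
  -- probability formula covers both.
  have hμu : μD univ = ENNReal.ofReal
      (1 - Real.exp (-(lam * meanHits mu ra rs (rimDist re ra rs)))) := by
    rw [hμ univ MeasurableSet.univ, ← h.measure_ne_zero hrs0 hra0 hlam hmu
      (z := rimDist re ra rs) (Real.sqrt_nonneg _) (cosAngle_rimDist_nonneg hre hra hrs0 hcap)
      (measurableSet_extendedCap re ra rs)
      (fun x hx => ⟨hx.1, hx.2.le⟩) fun x hx => hx]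
    refine measure_congr ?_
    filter_upwards [hcount] with ω hω
    refine propext ?_
    change (_ ≠ ∞ ∧ True) ↔ _ ≠ 0
    rw [and_true, servingDist_ne_top_iff hω]
  have hρu : ρ univ = ENNReal.ofReal
      (1 - Real.exp (-(lam * meanHits mu ra rs (rimDist re ra rs)))) := by
    rw [hρ' univ MeasurableSet.univ, univ_inter]
    exact lintegral_servingKernel hra0 hrs hlam hmu hlt.le
      (cosAngle_rimDist_nonneg hre hra hrs0 hcap)
  have hmid : ∀ z ∈ Icc (rs - ra) (rimDist re ra rs), μD (Iio z) =
      ENNReal.ofReal (1 - Real.exp (-(lam * meanHits mu ra rs z))) ∧ ρ (Iio z) =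
      ENNReal.ofReal (1 - Real.exp (-(lam * meanHits mu ra rs z))) := by
    intro z hz
    have hc := (cosAngle_mem hre hra hrs hcap hz).1
    constructor
    · rw [hμ _ measurableSet_Iio, ← h.measure_ne_zero hrs0 hra0 hlam hmu (by linarith [hz.1]) hc
        (measurableSet_openCap ra rs z) subset_rfl fun x hx => ⟨hx.1, hx.2.le⟩]
      refine measure_congr ?_
      filter_upwards [hcount] with ω hω
      refine propext ?_
      change (_ ≠ ∞ ∧ _ < z) ↔ _ ≠ 0
      rw [← servingDist_lt_ofReal_iff hω hz.2]
      constructor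
      · rintro ⟨h1, h2⟩
        exact (ENNReal.lt_ofReal_iff_toReal_lt h1).2 h2
      · intro h1
        exact ⟨h1.ne_top, (ENNReal.lt_ofReal_iff_toReal_lt h1.ne_top).1 h1⟩
    · rw [hρ' _ measurableSet_Iio, ← lintegral_servingKernel hra0 hrs hlam hmu hz.1 hc]
      have : Iio z ∩ Ioo (rs - ra) (rimDist re ra rs) = Ioo (rs - ra) z := by
        ext t
        simp only [mem_inter_iff, mem_Iio, mem_Ioo]
        exact ⟨fun ht => ⟨ht.2.1, ht.1⟩, fun ht => ⟨ht.2, ht.1, ht.2.trans_le hz.2⟩⟩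
      rw [this]
      rfl
  have hfinite : IsFiniteMeasure μD := by
    rw [hμD]; infer_instance
  -- These are sub-probability measures, so equality of total masses has to be supplied along with
  -- the π-system of half-lines.
  refine ext_of_generate_finite _ (borel_eq_generateFrom_Iio ℝ ▸ BorelSpace.measurable_eq)
    isPiSystem_Iio ?_ (hμu.trans hρu.symm)
  rintro _ ⟨z, rfl⟩
  rcases lt_or_ge z (rs - ra) with hz | hz
  -- At z = rs - ra the mass is the integral of the kernel over an empty interval, so both measures
  -- vanish below it.
  · have hzero : ENNReal.ofReal (1 - Real.exp (-(lam * meanHits mu ra rs (rs - ra)))) = 0 := by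
      have := lintegral_servingKernel hra0 hrs hlam hmu le_rfl
        (cosAngle_mem hre hra hrs hcap ⟨le_rfl, hlt.le⟩).1
      rw [← this, Ioo_self, Measure.restrict_empty, lintegral_zero_measure]
    obtain ⟨h1, h2⟩ := hmid _ ⟨le_rfl, hlt.le⟩
    rw [hzero] at h1 h2
    rw [measure_mono_null (Iio_subset_Iio hz.le) h1, measure_mono_null (Iio_subset_Iio hz.le) h2]
  · rcases le_or_gt z (rimDist re ra rs) with hz2 | hz2
    · rw [(hmid z ⟨hz, hz2⟩).1, (hmid z ⟨hz, hz2⟩).2]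
    · have e1 : μD (Iio z) = μD univ := by
        rw [hμ _ measurableSet_Iio, hμ _ MeasurableSet.univ]
        congr 1
        ext ω
        simp only [mem_ofPred_eq, mem_Iio, mem_univ, and_true, and_iff_left_iff_imp]
        intro hne
        refine lt_of_le_of_lt ?_ hz2
        exact ENNReal.toReal_le_of_le_ofReal (Real.sqrt_nonneg _) (servingDist_le_of_ne_top hne)
      have e2 : ρ (Iio z) = ρ univ := by
        rw [hρ' _ measurableSet_Iio, hρ' _ MeasurableSet.univ, univ_inter, inter_eq_right.2]
        exact fun t ht => ht.2.trans hz2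
      rw [e1, e2, hμu, hρu]

end

/-! ### Integrals against the kernel -/

section

variable {re ra rs lam mu : ℝ}

theorem servingKernel_nonneg (hrs : 0 < rs) (hra : 0 < ra) (hlam : 0 < lam) (hmu : 0 < mu) {t : ℝ}
    (ht : 0 ≤ t) (v : ℝ) : 0 ≤ servingKernel lam mu ra rs t v :=
  mul_nonneg (mul_nonneg hlam.le (Real.exp_nonneg _)) (hitDensity_nonneg hrs hra hmu ht v)

theorem lintegral_servingDensity_ne_top (hre : 0 < re) (hra : re < ra) (hrs : ra < rs)
    (hcap : capAngle re ra rs ≤ Real.pi / 2) (hlam : 0 < lam) (hmu : 0 < mu) :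
    ∫⁻ t in Ioo (rs - ra) (rimDist re ra rs), servingDensity lam mu ra rs t ≠ ∞ := by
  have hrs0 := (hre.trans hra).trans hrs
  have := lintegral_servingKernel (lam := lam) (mu := mu) (hre.trans hra) hrs hlam hmu
    (sub_lt_rimDist hre hra hrs0 hcap).le (cosAngle_rimDist_nonneg hre hra hrs0 hcap)
  unfold servingDensity
  rw [this]
  exact ENNReal.ofReal_ne_top

theorem measurableSet_integrationDomain (re ra rs : ℝ) :
    MeasurableSet (integrationDomain re ra rs) := by
  have hz : Measurable fun q : ℝ × ℝ => zeta ra rs q.1 := by unfold zeta; fun_prop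
  exact (measurable_fst measurableSet_Ioo).inter
    ((measurableSet_lt measurable_const measurable_snd).inter (measurableSet_lt measurable_snd hz))

theorem integrableOn_mul_rangeKernel (hre : 0 < re) (hra : re < ra) (hrs : ra < rs)
    (hcap : capAngle re ra rs ≤ Real.pi / 2) (hlam : 0 < lam) (hmu : 0 < mu) {w : ℝ → ℝ}
    (hw : Measurable w) {C : ℝ} (hwC : ∀ z, ‖w z‖ ≤ C) :
    IntegrableOn (fun q : ℝ × ℝ => w q.1 * rangeKernel lam mu ra rs q.1 q.2)
      (integrationDomain re ra rs) := by
  have hra0 := hre.trans hra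
  have hrs0 := hra0.trans hrs
  have hmem : ∀ q ∈ integrationDomain re ra rs, cosAngle ra rs q.1 ∈ Icc 0 1 := fun q hq =>
    cosAngle_mem hre hra hrs hcap ⟨hq.1.1.le, hq.1.2.le⟩
  have hsub : integrationDomain re ra rs ⊆
      Ioo (rs - ra) (rimDist re ra rs) ×ˢ Ioo 0 (Real.pi / 2) := fun q hq =>
    ⟨hq.1, hq.2.1, hq.2.2.trans_le (zeta_le (hmem q hq).1)⟩
  have hK : IntegrableOn (Function.uncurry (servingKernel lam mu ra rs))
      (Ioo (rs - ra) (rimDist re ra rs) ×ˢ Ioo 0 (Real.pi / 2)) := by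
    refine ⟨(measurable_servingKernel lam mu ra rs).aestronglyMeasurable, ?_⟩
    rw [hasFiniteIntegral_iff_ofReal, Measure.volume_eq_prod, ← Measure.prod_restrict,
      lintegral_prod _ (measurable_servingKernel lam mu ra rs).ennreal_ofReal.aemeasurable]
    · exact (lintegral_servingDensity_ne_top hre hra hrs hcap hlam hmu).lt_top
    · refine (ae_restrict_iff' (measurableSet_Ioo.prod measurableSet_Ioo)).2
        (ae_of_all _ fun q hq => ?_)
      exact servingKernel_nonneg hrs0 hra0 hlam hmu (by linarith [hq.1.1]) _
  refine IntegrableOn.congr_fun (f := fun q : ℝ × ℝ => w q.1 * servingKernel lam mu ra rs q.1 q.2)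
    ?_ (fun q hq => ?_) (measurableSet_integrationDomain re ra rs)
  · exact Integrable.bdd_mul (hK.mono_set hsub) (hw.comp measurable_fst).aestronglyMeasurable
      (ae_of_all _ fun q => hwC q.1)
  · beta_reduce
    rw [rangeKernel_eq_servingKernel (hmem q hq).1 (hmem q hq).2 hq.2]

theorem integral_mul_rangeKernel (hra : 0 < ra) (hrs : ra < rs) (hlam : 0 < lam)
    (hmu : 0 < mu) {z : ℝ} (hz : rs - ra < z) (hc : cosAngle ra rs z ∈ Icc 0 1) {x : ℝ}
    (hx : 0 ≤ x) :
    ∫ v in (0 : ℝ)..zeta ra rs z, x * rangeKernel lam mu ra rs z v =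
      (ENNReal.ofReal x * servingDensity lam mu ra rs z).toReal := by
  have hrs0 := hra.trans hrs
  rw [intervalIntegral.integral_const_mul, ENNReal.toReal_mul, ENNReal.toReal_ofReal hx,
    intervalIntegral.integral_of_le (zeta_nonneg _ _ _), integral_Ioc_eq_integral_Ioo,
    setIntegral_congr_fun measurableSet_Ioo fun v hv => rangeKernel_eq_servingKernel hc.1 hc.2 hv]
  congr 1
  rw [servingDensity, ← integral_eq_lintegral_of_nonneg_ae
    (ae_of_all _ fun v => servingKernel_nonneg hrs0 hra hlam hmu (by linarith) v)
    (measurable_servingKernel lam mu ra rs).of_uncurry_left.aestronglyMeasurable]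
  symm
  refine setIntegral_eq_of_subset_of_forall_sdiff_eq_zero measurableSet_Ioo
    (Ioo_subset_Ioo_right (zeta_le hc.1)) fun v hv => ?_
  refine servingKernel_eq_zero hc.1 hc.2 ?_ hv.1.2.le
  by_contra! hcon
  exact hv.2 ⟨hv.1.1, hcon⟩

/-- The passage from real iterated integrals to the extended-real density of D: endpoints are null,
and the density is finite almost everywhere because its total mass is finite. -/
theorem integral_integral_mul_rangeKernel (hre : 0 < re) (hra : re < ra) (hrs : ra < rs)
    (hcap : capAngle re ra rs ≤ Real.pi / 2) (hlam : 0 < lam) (hmu : 0 < mu) {w : ℝ → ℝ}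
    (hw : Measurable w) (hw0 : ∀ z, 0 ≤ w z) {B : Set ℝ} (hB : MeasurableSet B) :
    ∫ z in B ∩ Icc (rs - ra) (rimDist re ra rs), ∫ v in (0 : ℝ)..zeta ra rs z,
      w z * rangeKernel lam mu ra rs z v =
    (∫⁻ z in B ∩ Ioo (rs - ra) (rimDist re ra rs),
      ENNReal.ofReal (w z) * servingDensity lam mu ra rs z).toReal := by
  have hset : (B ∩ Ioo (rs - ra) (rimDist re ra rs) : Set ℝ) =ᵐ[volume]
      (B ∩ Icc (rs - ra) (rimDist re ra rs) : Set ℝ) :=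
    (ae_eq_refl B).inter Ioo_ae_eq_Icc
  have hm := measurable_servingDensity lam mu ra rs
  rw [← setIntegral_congr_set hset, ← integral_toReal]
  · refine setIntegral_congr_fun (hB.inter measurableSet_Ioo) fun z hz => ?_
    exact integral_mul_rangeKernel (hre.trans hra) hrs hlam hmu hz.2.1
      (cosAngle_mem hre hra hrs hcap ⟨hz.2.1.le, hz.2.2.le⟩) (hw0 z)
  · exact (by fun_prop : Measurable _).aemeasurable
  · have h := ae_lt_top hm (lintegral_servingDensity_ne_top hre hra hrs hcap hlam hmu)
    filter_upwards [ae_restrict_of_ae_restrict_of_subset inter_subset_right h] with z hz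
    exact ENNReal.mul_lt_top ENNReal.ofReal_lt_top hz

end

/-! ### Coverage probability of the platform -/

section

variable {Ω : Type*} [MeasurableSpace Ω] {P : Measure Ω} [IsProbabilityMeasure P]
  {re ra rs lam mu : ℝ} {Ξ : Ω → Measure (ℝ × ℝ)} {Ψ : Ω → Measure E3}

theorem IsSatelliteNetwork.measureReal_servingDist (h : IsSatelliteNetwork rs lam mu Ξ Ψ P)
    (hre : 0 < re) (hra : re < ra) (hrs : ra < rs) (hcap : capAngle re ra rs ≤ Real.pi / 2)
    (hlam : 0 < lam) (hmu : 0 < mu) {B : Set ℝ} (hB : MeasurableSet B) :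
    P.real {ω | servingDist re ra rs (Ψ ω) ≠ ∞ ∧ (servingDist re ra rs (Ψ ω)).toReal ∈ B} =
      ∫ z in B ∩ Icc (rs - ra) (rimDist re ra rs),
        ∫ v in (0 : ℝ)..zeta ra rs z, rangeKernel lam mu ra rs z v := by
  have hD : Measurable fun ω => countingServingDist re ra rs (Ψ ω) :=
    (measurable_countingServingDist re ra rs).comp h.satellites.measurable
  have hR := integral_integral_mul_rangeKernel hre hra hrs hcap hlam hmu
    (w := fun _ => 1) measurable_const (fun _ => zero_le_one) hB
  simp only [one_mul, ENNReal.ofReal_one] at hR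
  rw [hR, measureReal_def]
  congr 1
  have hlaw := congrArg (fun μ => μ B) (h.map_countingServingDist hre hra hrs hcap hlam hmu)
  rw [withDensity_apply _ hB, Measure.restrict_restrict hB] at hlaw
  rw [← hlaw, Measure.map_apply hD.ennreal_toReal hB,
    Measure.restrict_apply (hD.ennreal_toReal hB)]
  refine measure_congr ?_
  filter_upwards [h.satellites.counting] with ω hω
  refine propext ?_
  change (_ ≠ ∞ ∧ _ ∈ B) ↔ (_ ∈ B ∧ _ ≠ ∞)
  rw [servingDist_eq_countingServingDist hω, and_comm]

/-- Positivity of τ excludes the case without satellite, where the SNR is 0. The distance is at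
least rs - ra > 0, so its power can be moved across the inequality. -/
theorem le_snrPlatform_iff {alpha ps gs ga N0 Bs τ H : ℝ} {m : Measure E3} (hra : 0 < ra)
    (hrs : ra < rs) (hps : 0 < ps) (hgs : 0 < gs) (hga : 0 < ga) (hN0 : 0 < N0) (hBs : 0 < Bs)
    (hτ : 0 < τ) :
    τ ≤ snrPlatform re ra rs alpha ps gs ga N0 Bs H m ↔ servingDist re ra rs m ≠ ∞ ∧
      τ * (servingDist re ra rs m).toReal ^ alpha / (ps * ga * gs / (N0 * Bs)) ≤ H := by
  unfold snrPlatform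
  split_ifs with htop
  · simp [htop, hτ]
  · have hpos : 0 < (servingDist re ra rs m).toReal := by
      refine ENNReal.toReal_pos (fun h0 => ?_) htop
      have := ofReal_sub_le_servingDist (re := re) (rs := rs) (m := m) hra.le
      rw [h0, nonpos_iff_eq_zero, ENNReal.ofReal_eq_zero] at this
      linarith
    have hp := Real.rpow_pos_of_pos hpos alpha
    rw [Real.rpow_neg hpos.le, and_iff_right htop, div_le_iff₀ (by positivity),
      le_div_iff₀ (by positivity), ← div_eq_mul_inv, le_div_iff₀ hp]
    have e : H * (ps * ga * gs / (N0 * Bs)) = ps * (gs * ga) * H / (N0 * Bs) := by ring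
    rw [e, le_div_iff₀ (by positivity)]
    constructor <;> intro h <;> linarith

theorem measurable_measure_Ici (ν : Measure ℝ) [IsFiniteMeasure ν] :
    Measurable fun x : ℝ => ν (Ici x) :=
  Antitone.measurable fun _ _ hxy => measure_mono (Ici_subset_Ici.2 hxy)

theorem measurable_ccdf (ν : Measure ℝ) [IsFiniteMeasure ν] : Measurable (ccdf ν) :=
  (measurable_measure_Ici ν).ennreal_toReal

theorem ofReal_ccdf (ν : Measure ℝ) [IsFiniteMeasure ν] (x : ℝ) :
    ENNReal.ofReal (ccdf ν x) = ν (Ici x) := ofReal_measureReal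

/-- The coverage probability for a threshold that depends on the serving distance. -/
theorem IsSatelliteNetwork.measureReal_threshold_le (h : IsSatelliteNetwork rs lam mu Ξ Ψ P)
    (hre : 0 < re) (hra : re < ra) (hrs : ra < rs) (hcap : capAngle re ra rs ≤ Real.pi / 2)
    (hlam : 0 < lam) (hmu : 0 < mu) {ν : Measure ℝ} [IsProbabilityMeasure ν] {H : Ω → ℝ}
    (hH : HasLaw H ν P) (hindep : IndepFun H Ψ P) {T : ℝ → ℝ} (hT : Measurable T) :
    P.real {ω | servingDist re ra rs (Ψ ω) ≠ ∞ ∧ T (servingDist re ra rs (Ψ ω)).toReal ≤ H ω} =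
      ∫ z in (rs - ra)..rimDist re ra rs, ∫ v in (0 : ℝ)..zeta ra rs z,
        ccdf ν (T z) * rangeKernel lam mu ra rs z v := by
  have hrs0 := (hre.trans hra).trans hrs
  have hlt := sub_lt_rimDist hre hra hrs0 hcap
  have hD : Measurable fun ω => countingServingDist re ra rs (Ψ ω) :=
    (measurable_countingServingDist re ra rs).comp h.satellites.measurable
  have hind : IndepFun (fun ω => countingServingDist re ra rs (Ψ ω)) H P :=
    (hindep.comp measurable_id (measurable_countingServingDist re ra rs)).symm
  -- Independence makes the joint law of distance and fading a product, so the fading can be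
  -- integrated out at fixed distance.
  have hprod := (indepFun_iff_map_prod_eq_prod_map_map hD.aemeasurable hH.aemeasurable).1 hind
  rw [hH.map_eq] at hprod
  have hR := integral_integral_mul_rangeKernel hre hra hrs hcap hlam hmu
    (w := fun z => ccdf ν (T z)) ((measurable_ccdf ν).comp hT) (fun _ => measureReal_nonneg)
    MeasurableSet.univ
  rw [univ_inter, univ_inter] at hR
  rw [intervalIntegral.integral_of_le hlt.le, ← integral_Icc_eq_integral_Ioc, hR, measureReal_def]
  congr 1
  let S : Set (ℝ≥0∞ × ℝ) := {q | q.1 ≠ ∞ ∧ T q.1.toReal ≤ q.2}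
  have hS : MeasurableSet S :=
    (measurable_fst (measurableSet_singleton ∞)).compl.inter
      (measurableSet_le (hT.comp measurable_fst.ennreal_toReal) measurable_snd)
  have hG : Measurable fun x => ν (Ici (T x)) := (measurable_measure_Ici ν).comp hT
  have hfin : MeasurableSet {x : ℝ≥0∞ | x ≠ ∞} := (measurableSet_singleton ∞).compl
  calc P {ω | servingDist re ra rs (Ψ ω) ≠ ∞ ∧ T (servingDist re ra rs (Ψ ω)).toReal ≤ H ω}
      = P ((fun ω => (countingServingDist re ra rs (Ψ ω), H ω)) ⁻¹' S) := by
        refine measure_congr ?_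
        filter_upwards [h.satellites.counting] with ω hω
        refine propext ?_
        change (_ ≠ ∞ ∧ T _ ≤ _) ↔ (_ ≠ ∞ ∧ T _ ≤ _)
        rw [servingDist_eq_countingServingDist hω]
    _ = ∫⁻ d, ν (Prod.mk d ⁻¹' S) ∂P.map fun ω => countingServingDist re ra rs (Ψ ω) := by
        rw [← Measure.map_apply_of_aemeasurable (hD.aemeasurable.prodMk hH.aemeasurable) hS,
          hprod, Measure.prod_apply hS]
    _ = ∫⁻ d in {x : ℝ≥0∞ | x ≠ ∞}, ν (Ici (T d.toReal))
          ∂P.map fun ω => countingServingDist re ra rs (Ψ ω) := by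
        rw [← lintegral_indicator hfin]
        refine lintegral_congr fun d => ?_
        -- The section of `S` over d = ∞ is empty, which restricts the integral to finite distances.
        by_cases hd : d = ∞
        · simp [hd, S]
        · rw [indicator_of_mem (by exact hd)]
          congr 1
          ext y
          simp [S, hd]
    _ = ∫⁻ x, ν (Ici (T x)) ∂(P.restrict {ω | countingServingDist re ra rs (Ψ ω) ≠ ∞}).map
          (fun ω => (countingServingDist re ra rs (Ψ ω)).toReal) := by
        rw [lintegral_map hG hD.ennreal_toReal, Measure.restrict_map hD hfin,
          lintegral_map (f := fun d : ℝ≥0∞ => ν (Ici (T d.toReal)))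
            (hG.comp ENNReal.measurable_toReal) hD]
        rfl
    _ = ∫⁻ z in Ioo (rs - ra) (rimDist re ra rs),
          ENNReal.ofReal (ccdf ν (T z)) * servingDensity lam mu ra rs z := by
        rw [h.map_countingServingDist hre hra hrs hcap hlam hmu,
          lintegral_withDensity_eq_lintegral_mul _ (measurable_servingDensity lam mu ra rs) hG]
        refine lintegral_congr fun z => ?_
        rw [ofReal_ccdf, Pi.mul_apply, mul_comm]

end

/-! ### The gateway link and Nakagami fading -/

theorem dist_northPoint {re ra : ℝ} (h : re < ra) :
    dist (northPoint ra) (northPoint re) = ra - re := by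
  rw [EuclideanSpace.dist_eq, Fin.sum_univ_three]
  simp [northPoint, Real.dist_eq, Real.sqrt_sq (sub_pos.2 h).le]

theorem le_snrGateway_iff {re ra alpha pa ga gg N0 Ba τ H : ℝ} (hra : re < ra) (hpa : 0 < pa)
    (hga : 0 < ga) (hgg : 0 < gg) (hN0 : 0 < N0) (hBa : 0 < Ba) :
    τ ≤ snrGateway re ra alpha pa ga gg N0 Ba H ↔
      τ * (ra - re) ^ alpha / (pa * ga * gg / (N0 * Ba)) ≤ H := by
  have hpos : 0 < ra - re := sub_pos.2 hra
  have hp := Real.rpow_pos_of_pos hpos alpha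
  rw [snrGateway, dist_northPoint hra, Real.rpow_neg hpos.le, div_le_iff₀ (by positivity),
    le_div_iff₀ (by positivity), ← div_eq_mul_inv, le_div_iff₀ hp]
  have e : H * (pa * ga * gg / (N0 * Ba)) = pa * (ga * gg) * H / (N0 * Ba) := by ring
  rw [e, le_div_iff₀ (by positivity)]
  constructor <;> intro h <;> linarith

theorem measureReal_le_eq_ccdf {Ω : Type*} [MeasurableSpace Ω] {P : Measure Ω} {ν : Measure ℝ}
    {H : Ω → ℝ} (hH : HasLaw H ν P) (x : ℝ) : P.real {ω | x ≤ H ω} = ccdf ν x := by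
  rw [ccdf, ← hH.map_eq, map_measureReal_apply_of_aemeasurable hH.aemeasurable measurableSet_Ici]
  rfl

/-- The scale m / W is the reciprocal of the rate parameter of the gamma law. -/
theorem nakagamiLaw_eq_gammaMeasure {m W : ℝ} (hm : 0 < m) (hW : 0 < W) :
    nakagamiLaw m W = gammaMeasure m (W / m) := by
  rw [nakagamiLaw, gammaMeasure]
  congr 1
  ext x
  rw [gammaPDF, gammaPDFReal]
  congr 1
  split_ifs with hx
  · have e1 : -x / (m / W) = -(W / m * x) := by field_simp
    have e2 : (W / m) ^ m = ((m / W) ^ m)⁻¹ := by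
      rw [← Real.inv_rpow (by positivity), inv_div]
    have h1 := Real.rpow_pos_of_pos (div_pos hm hW) m
    have h2 := Real.Gamma_pos_of_pos hm
    rw [e1, e2]
    field_simp
  · rfl

/-- Complementation reduces to the mass of [0, x), and scaling the variable by r turns it into the
incomplete gamma integral. -/
theorem ccdf_gammaMeasure {a r : ℝ} (ha : 0 < a) (hr : 0 < r) {x : ℝ} (hx : 0 ≤ x) :
    ccdf (gammaMeasure a r) x = 1 - lowerGamma a (r * x) / Real.Gamma a := by
  have := isProbabilityMeasure_gammaMeasure ha hr
  have hG := Real.Gamma_pos_of_pos ha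
  have hcompl : ccdf (gammaMeasure a r) x = 1 - (gammaMeasure a r).real (Iio x) := by
    rw [ccdf, ← compl_Iio, probReal_compl_eq_one_sub measurableSet_Iio]
  have hint : IntervalIntegrable (fun t : ℝ => t ^ (a - 1) * Real.exp (-t)) volume 0 (r * x) := by
    rw [intervalIntegrable_iff_integrableOn_Ioc_of_le (by positivity)]
    refine ((Real.GammaIntegral_convergent ha).congr_fun (fun t _ => mul_comm _ _)
      measurableSet_Ioi).mono_set Ioc_subset_Ioi_self
  rw [hcompl]
  congr 1
  have hIio : (gammaMeasure a r).real (Iio x) =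
      ∫ t in (0 : ℝ)..x, gammaPDFReal a r t := by
    rw [measureReal_def, gammaMeasure, withDensity_apply _ measurableSet_Iio]
    have h0 : ∫⁻ t in Iio x, gammaPDF a r t = ∫⁻ t in Ioo 0 x, gammaPDF a r t := by
      rw [← Iio_union_Ico_eq_Iio hx, lintegral_union measurableSet_Ico,
        lintegral_gammaPDF_of_nonpos le_rfl, zero_add, setLIntegral_congr Ioo_ae_eq_Ico.symm]
      exact disjoint_left.2 fun t ht ht2 => ht2.1.not_gt ht
    rw [h0, intervalIntegral.integral_of_le hx, integral_Ioc_eq_integral_Ioo,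
      integral_eq_lintegral_of_nonneg_ae (ae_of_all _ fun t => gammaPDFReal_nonneg ha hr t)
        (stronglyMeasurable_gammaPDFReal a r).aestronglyMeasurable]
    rfl
  have hsub : ∫ t in (0 : ℝ)..x, gammaPDFReal a r t =
      ∫ t in (0 : ℝ)..x, r / Real.Gamma a * ((r * t) ^ (a - 1) * Real.exp (-(r * t))) := by
    refine intervalIntegral.integral_congr fun t ht => ?_
    rw [uIcc_of_le hx] at ht
    rw [gammaPDFReal, if_pos ht.1, Real.mul_rpow hr.le ht.1]
    have : r ^ a = r * r ^ (a - 1) := by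
      rw [← Real.rpow_one_add' hr.le (by simpa using ha.ne')]
      ring_nf
    rw [this]
    ring
  rw [hIio, hsub, intervalIntegral.integral_const_mul,
    intervalIntegral.integral_comp_mul_left (fun t => t ^ (a - 1) * Real.exp (-t)) hr.ne',
    mul_zero, lowerGamma, smul_eq_mul]
  field_simp

end SatNet

theorem theorem4 {Ω : Type*} [MeasurableSpace Ω] (P : Measure Ω) [IsProbabilityMeasure P]
    (re ra rs lam mu alpha ps pa gs ga gg N0 Bs Ba : ℝ)
    (hre : 0 < re) (hra : re < ra) (hrs : ra < rs)
    (hcap : SatNet.capAngle re ra rs ≤ Real.pi / 2)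
    (hlam : 0 < lam) (hmu : 0 < mu) (halpha : 2 ≤ alpha)
    (hps : 0 < ps) (hpa : 0 < pa) (hgs : 0 < gs) (hga : 0 < ga) (hgg : 0 < gg)
    (hN0 : 0 < N0) (hBs : 0 < Bs) (hBa : 0 < Ba)
    -- the orbits and the satellites
    (Ξ : Ω → Measure (ℝ × ℝ)) (Ψ : Ω → Measure SatNet.E3)
    (hnet : SatNet.IsSatelliteNetwork rs lam mu Ξ Ψ P)
    -- the fading of the two links: any common law `ν`, independent of the satellites
    (ν : Measure ℝ) [IsProbabilityMeasure ν] (Hs Ha : Ω → ℝ)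
    (hHs : HasLaw Hs ν P) (hHa : HasLaw Ha ν P) (hindep : IndepFun Hs Ψ P) :
    -- the integral over `v` is the density of the distance to the serving satellite
    (IntegrableOn (fun q : ℝ × ℝ => SatNet.rangeKernel lam mu ra rs q.1 q.2)
        (SatNet.integrationDomain re ra rs) ∧
      ∀ B : Set ℝ, MeasurableSet B →
        P.real {ω | SatNet.servingDist re ra rs (Ψ ω) ≠ ∞ ∧
            (SatNet.servingDist re ra rs (Ψ ω)).toReal ∈ B} =
          ∫ z in B ∩ Icc (rs - ra) (SatNet.rimDist re ra rs),
            ∫ v in (0 : ℝ)..SatNet.zeta ra rs z, SatNet.rangeKernel lam mu ra rs z v) ∧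
    -- the SNR coverage probability of the typical aerial platform
    (∀ τ : ℝ, 0 < τ →
      IntegrableOn (fun q : ℝ × ℝ =>
          SatNet.ccdf ν (τ * q.1 ^ alpha / (ps * ga * gs / (N0 * Bs))) *
            SatNet.rangeKernel lam mu ra rs q.1 q.2)
        (SatNet.integrationDomain re ra rs) ∧
      P.real {ω | τ ≤ SatNet.snrPlatform re ra rs alpha ps gs ga N0 Bs (Hs ω) (Ψ ω)} =
        ∫ z in (rs - ra)..SatNet.rimDist re ra rs, ∫ v in (0 : ℝ)..SatNet.zeta ra rs z,
          SatNet.ccdf ν (τ * z ^ alpha / (ps * ga * gs / (N0 * Bs))) *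
            SatNet.rangeKernel lam mu ra rs z v) ∧
    -- the SNR coverage probability of the typical gateway
    (∀ τ : ℝ, 0 < τ →
      P.real {ω | τ ≤ SatNet.snrGateway re ra alpha pa ga gg N0 Ba (Ha ω)} =
        SatNet.ccdf ν (τ * (ra - re) ^ alpha / (pa * ga * gg / (N0 * Ba)))) ∧
    -- the complementary distribution function for Nakagami fading
    (∀ m W : ℝ, 0 < m → 0 < W → IsProbabilityMeasure (SatNet.nakagamiLaw m W) ∧
      ∀ x : ℝ, 0 ≤ x →
        SatNet.ccdf (SatNet.nakagamiLaw m W) x =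
          1 - SatNet.lowerGamma m (W * x / m) / Real.Gamma m) := by
  have hrs0 := (hre.trans hra).trans hrs
  refine ⟨⟨?_, fun B hB => ?_⟩, fun τ hτ => ⟨?_, ?_⟩, fun τ _ => ?_, fun m W hm hW => ⟨?_, ?_⟩⟩
  · simpa using SatNet.integrableOn_mul_rangeKernel hre hra hrs hcap hlam hmu (w := fun _ => 1)
      measurable_const (C := 1) (by simp)
  · exact hnet.measureReal_servingDist hre hra hrs hcap hlam hmu hB
  · refine SatNet.integrableOn_mul_rangeKernel hre hra hrs hcap hlam hmu
      (w := fun z => SatNet.ccdf ν (τ * z ^ alpha / (ps * ga * gs / (N0 * Bs))))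
      ((SatNet.measurable_ccdf ν).comp (by fun_prop)) (C := 1) fun z => ?_
    rw [SatNet.ccdf, Real.norm_of_nonneg measureReal_nonneg]
    exact measureReal_le_one
  -- Coverage becomes the event that the fading reaches a threshold depending only on the serving
  -- distance.
  · simp_rw [SatNet.le_snrPlatform_iff (hre.trans hra) hrs hps hgs hga hN0 hBs hτ]
    exact hnet.measureReal_threshold_le hre hra hrs hcap hlam hmu hHs hindep
      (T := fun z => τ * z ^ alpha / (ps * ga * gs / (N0 * Bs))) (by fun_prop)
  · simp_rw [SatNet.le_snrGateway_iff hra hpa hga hgg hN0 hBa]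
    exact SatNet.measureReal_le_eq_ccdf hHa _
  · rw [SatNet.nakagamiLaw_eq_gammaMeasure hm hW]
    exact isProbabilityMeasure_gammaMeasure hm (div_pos hW hm)
  · intro x hx
    rw [SatNet.nakagamiLaw_eq_gammaMeasure hm hW, SatNet.ccdf_gammaMeasure hm (div_pos hW hm) hx,
      div_mul_eq_mul_div]
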